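/- Let $k$ be a field, $V$ a finite dimensional $k$-vector space, and $2\le a<b$ integers. Write $V^{(n)}=V^{\otimes n}$ for $n\ge 0$ (so $V^{(0)}=k$) and $V^{(n)}=0$ for $n<0$; all tensor products of subspaces below are regarded as subspaces of the tensor powers $V^{(n)}$, and empty sums are $0$. Let $R_a\subseteq V^{(a)}$ and $R_b\subseteq V^{(b)}$ be subspaces satisfying the minimality condition $R_b\cap\sum_{j=0}^{b-a}V^{(j)}\otimes R_a\otimes V^{(b-a-j)}=0$, and let $A=T(V)/\langle R_a\oplus R_b\rangle$ (an $\{a,b\}$-multi-homogeneous algebra). **Notation.** Let $I_n=\sum_{s\in\{a,b\}}\sum_{j=0}^{n-s}V^{(j)}\otimes R_s\otimes V^{(n-s-j)}$ be the degree $n$ component of the ideal $\langle R_a\oplus R_b\rangle$ (so $I_n=0$ for $n<a$). For $s\in\{a,b\}$ put $n_s(2l)=sl$, $n_s(2l+1)=sl+1$; put $\bar J^s_m=\bigcap_{j=0}^{m-s}V^{(j)}\otimes R_s\otimes V^{(m-s-j)}$ for $m\ge s$ and $\bar J^s_m=V^{(m)}$ for $0\le m<s$. Put $J_0=k$, $J_1=V$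 and $J_i=\bar J^a_{n_a(i)}\oplus \bar J^b_{n_b(i)}$ for $i\ge 2$. **Multi-Koszul.** The left multi-Koszul complex of $A$ has terms $K(A)_i=A\otimes J_i$, augmentation $\delta_0:A\to k$, $\delta_1:A\otimes V\to A$ given by the multiplication, and, for $i\ge 2$, $\delta_i:A\otimes J_i\to A\otimes J_{i-1}$ the restriction of the map given on $A\otimes V^{(n_s(i))}$, for $s\in\{a,b\}$, by $\alpha\otimes v_1\cdots v_{n_s(i)}\mapsto \alpha v_1\cdots v_{s-1}\otimes v_s\cdots v_{n_s(i)}$ if $i$ is even and $\alpha\otimes v_1\cdots v_{n_s(i)}\mapsto\alpha v_1\otimes v_2\cdots v_{n_s(i)}$ if $i$ is odd. The algebra $A$ is $\{a,b\}$-multi-Koszul if the augmented complex $\cdots\to K(A)_1\to K(A)_0\to k\to 0$ is exact, i.e. is a projective resolution of the trivial left $A$-module $k$. **Lattice notions.** A sequence $(E,F_1,\dots,F_t)$ of subspaces of a vector space is distributive if $E\cap\sum_jF_j=\sum_j(E\cap F_j)$. A tuple $(E,E',F_1,\dots,F_t,G_1,\dots,G_{t'})$ is $(t,t')$-bidistributive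 if $E\cap E'=0$ and $(E\oplus E')\cap(\sum_jF_j+\sum_{j'}G_{j'})=\sum_j(E\cap F_j)\oplus\sum_{j'}(E'\cap G_{j'})$. For an integer $n$ define $$E'=V^{(n-a)}\otimes R_a,\qquad G'=\sum_{j=n-2a+1}^{n-a-1}V^{(j)}\otimes R_a\otimes V^{(n-a-j)},$$ $$F'=\sum_{j=0}^{n-2a}V^{(j)}\otimes R_a\otimes V^{(n-a-j)}+\sum_{j=0}^{n-a-b}V^{(j)}\otimes R_b\otimes V^{(n-b-j)},$$ $$E''=V^{(n-b)}\otimes R_b,\qquad G''=\sum_{j=n-2b+1}^{n-b-1}V^{(j)}\otimes R_b\otimes V^{(n-b-j)},$$ $$F''=\sum_{j=0}^{n-a-b}V^{(j)}\otimes R_a\otimes V^{(n-a-j)}+\sum_{j=0}^{n-2b}V^{(j)}\otimes R_b\otimes V^{(n-b-j)}.$$ For $i\ge 3$, $s,s'\in\{a,b\}$ and an integer $n$ define $E^s=V^{(n-n_s(i))}\otimes\bar J^s_{n_s(i)}$, $F^s=I_{n-n_s(i)}\otimes V^{(n_s(i))}$ and $$G^s_{s'}=\sum_{j=n-n_s(i)-s'+1}^{n-n_s(i-1)-s'}V^{(j)}\otimes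 R_{s'}\otimes V^{(n-s'-j)}.$$ Finally let $X^{a,m}_b=(V^{(m)}\otimes R_a)\cap\sum_{j=0}^{m+a-b-1}V^{(j)}\otimes R_b\otimes V^{(m+a-b-j)}$. **Theorem.** The following are equivalent. (i) All of the following hold: 1. (extra conditions) for $s=a$ and $s=b$, $\ (V^{(s-1)}\otimes R_s)\cap\sum_{j=0}^{s-2}V^{(j)}\otimes R_s\otimes V^{(s-1-j)}=V^{(s-2)}\otimes\bar J^s_{s+1}$; 2. for every even $i\ge 3$ and every $n$ with $n_a(i-1)+b\le n\le n_a(i)+b-1$, $$E^a\cap\bigl(X^{a,n-n_a(i)}_b\otimes V^{(n_a(i-2))}\bigr)\subseteq V^{(n-n_a(i+1))}\otimes\bar J^a_{n_a(i+1)}+I_{n-n_a(i)}\otimes\bar J^a_{n_a(i)};$$ 3. for every odd $i\ge 3$, $$(V^{(b-1)}\otimes\bar J^a_{n_a(i)})\cap\Bigl(\bigl((V^{(b-1)}\otimes R_a)\cap(R_b\otimes V^{(a-1)})\bigr)\otimes V^{(n_a(i-2))}\Bigr)\subseteq V^{(b-a)}\otimes\bar J^a_{n_a(i+1)}+I_{b-1}\otimes\bar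 J^a_{n_a(i)};$$ 4. for every $n\ge 0$ the tuple $(E',E'',F',G',F'',G'')$ is $(2,2)$-bidistributive; 5. for every $i\ge 3$, $s\in\{a,b\}$ and $n\ge 0$ the tuple $(E^s,F^s,G^s_a,G^s_b)$ is distributive. (i') The same conditions, where 4 is only required for $n>a$ and 5 only for $n\ge n_s(i)$. (ii) $A$ is $\{a,b\}$-multi-Koszul. -/

import Mathlib

open scoped TensorProduct

noncomputable section

namespace MultiKoszul

/-! ### Tensor powers inside the tensor algebra -/

section TensorPowers

variable (k V : Type*) [Field k] [AddCommGroup V] [Module k V]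

/-- The homogeneous component `V^{(n)} = V^{⊗ n}` of the tensor algebra `T(V)`, for `n : ℤ`, with
`V^{(n)} = 0` for `n < 0` and `V^{(0)} = k`.

For subspaces `X ⊆ V^{(m)}` and `Y ⊆ V^{(n)}`, the subspace `X ⊗ Y` of
`V^{(m)} ⊗ V^{(n)} = V^{(m + n)}` is the product `X * Y` of subspaces of the algebra `T(V)`. -/
def tpow (n : ℤ) : Submodule k (TensorAlgebra k V) :=
  if n < 0 then ⊥ else LinearMap.range (TensorAlgebra.ι k (M := V)) ^ n.toNat

/-- The algebra map `T(V) → End (T(V) × (V ⊗ T(V)))` sending `v ∈ V` to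
`(x, y) ↦ (v x, v ⊗ x)`; auxiliary for `firstLetter`. -/
def firstLetterAux :
    TensorAlgebra k V →ₐ[k]
      Module.End k (TensorAlgebra k V × (V ⊗[k] TensorAlgebra k V)) :=
  TensorAlgebra.lift k
    { toFun := fun v =>
        (LinearMap.prod (LinearMap.mulLeft k (TensorAlgebra.ι k v))
          (TensorProduct.mk k V (TensorAlgebra k V) v)) ∘ₗ LinearMap.fst k _ _
      map_add' := fun v w => by ext <;> simp [add_mul]
      map_smul' := fun c v => by ext <;> simp [TensorProduct.smul_tmul'] }

/-- The linear map `T(V) → V ⊗ T(V)` which splits off the first letter: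
`v₁ v₂ ⋯ vₙ ↦ v₁ ⊗ v₂ ⋯ vₙ` for `n ≥ 1`, and `1 ↦ 0`. -/
def firstLetter : TensorAlgebra k V →ₗ[k] V ⊗[k] TensorAlgebra k V :=
  LinearMap.snd k _ _ ∘ₗ LinearMap.applyₗ (1, 0) ∘ₗ (firstLetterAux k V).toLinearMap

variable {k V}

theorem firstLetterAux_fst (x : TensorAlgebra k V)
    (p : TensorAlgebra k V × (V ⊗[k] TensorAlgebra k V)) :
    (firstLetterAux k V x p).1 = x * p.1 := by
  induction x using TensorAlgebra.induction generalizing p with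
  | algebraMap r => simp [Algebra.smul_def]
  | ι v => simp [firstLetterAux]
  | mul x y hx hy => simp [hx, hy, mul_assoc]
  | add x y hx hy => simp [hx, hy, add_mul]

theorem firstLetter_ι_mul (v : V) (x : TensorAlgebra k V) :
    firstLetter k V (TensorAlgebra.ι k v * x) = v ⊗ₜ x := by
  have h := firstLetterAux_fst x ((1, 0) : TensorAlgebra k V × (V ⊗[k] TensorAlgebra k V))
  simp only [mul_one] at h
  simp only [firstLetter, LinearMap.comp_apply, AlgHom.toLinearMap_apply, map_mul,
    LinearMap.applyₗ_apply_apply, LinearMap.snd_apply, Module.End.mul_apply]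
  conv_rhs => rw [← h]
  simp [firstLetterAux]

theorem firstLetter_one : firstLetter k V 1 = 0 := by
  simp [firstLetter]

theorem tpow_natCast (n : ℕ) :
    tpow k V n = LinearMap.range (TensorAlgebra.ι k (M := V)) ^ n := by
  simp [tpow]

theorem tpow_add {m n : ℤ} (hm : 0 ≤ m) (hn : 0 ≤ n) :
    tpow k V (m + n) = tpow k V m * tpow k V n := by
  lift m to ℕ using hm
  lift n to ℕ using hn
  rw [← Nat.cast_add, tpow_natCast, tpow_natCast, tpow_natCast, pow_add]

end TensorPowers

/-! ### Multi-homogeneous algebras -/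

/-- The data presenting an `S`-multi-homogeneous algebra `T(V)/⟨R⟩`, for a finite set `S` of
integers `≥ 2`: a space of relations `R = ⨁_{s ∈ S} R_s` with `R_s ⊆ V^{(s)}` satisfying the
minimality condition
`R_s ∩ ∑_{t ∈ S, t < s} ∑_{j = 0}^{s - t} V^{(j)} ⊗ R_t ⊗ V^{(s - t - j)} = 0`. -/
structure Presentation (k V : Type*) [Field k] [AddCommGroup V] [Module k V] (S : Finset ℕ) where
  /-- the homogeneous components of the space of relations (only those in `S` are used) -/
  R : ℕ → Submodule k (TensorAlgebra k V)
  two_le : ∀ s ∈ S, 2 ≤ s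
  le_tpow : ∀ s ∈ S, R s ≤ tpow k V s
  minimal : ∀ s ∈ S, R s ⊓ (∑ t ∈ S with t < s, ∑ j ∈ Finset.Icc (0 : ℤ) (s - t),
    tpow k V j * R t * tpow k V (s - t - j)) = ⊥

/-- The function `n_s(2l) = s l`, `n_s(2l + 1) = s l + 1`. -/
def nDeg (s i : ℕ) : ℕ := s * (i / 2) + i % 2

namespace Presentation

variable {k V : Type*} [Field k] [AddCommGroup V] [Module k V] {S : Finset ℕ}
  (P : Presentation k V S)

/-- The two-sided ideal `⟨R⟩` of `T(V)` generated by the relations. -/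
def relIdeal : Ideal (TensorAlgebra k V) :=
  (TwoSidedIdeal.span (⋃ s ∈ S, (P.R s : Set (TensorAlgebra k V)))).asIdeal

instance : P.relIdeal.IsTwoSided := by
  unfold relIdeal; infer_instance

/-- The algebra `A = T(V)/⟨R⟩`. -/
abbrev Alg := TensorAlgebra k V ⧸ P.relIdeal

/-- The projection `T(V) → A`. -/
abbrev proj : TensorAlgebra k V →ₐ[k] P.Alg := Ideal.Quotient.mkₐ k P.relIdeal

theorem algebraMapInv_eq_zero_of_mem_tpow {n : ℕ} (hn : 1 ≤ n) {x : TensorAlgebra k V}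
    (hx : x ∈ tpow k V n) : TensorAlgebra.algebraMapInv x = (0 : k) := by
  obtain ⟨m, rfl⟩ := Nat.exists_eq_add_of_le' hn
  rw [tpow_natCast, pow_succ'] at hx
  refine Submodule.mul_induction_on hx ?_ ?_
  · rintro _ ⟨v, rfl⟩ y _
    simp [TensorAlgebra.algebraMapInv]
  · intro x y hx hy
    rw [map_add, hx, hy, add_zero]

/-- The augmentation `A → k`, which sends `V` to zero. -/
def augmentation : P.Alg →ₐ[k] k :=
  Ideal.Quotient.liftₐ P.relIdeal TensorAlgebra.algebraMapInv (by
    have h : TwoSidedIdeal.span (⋃ s ∈ S, (P.R s : Set (TensorAlgebra k V))) ≤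
        TwoSidedIdeal.ker (TensorAlgebra.algebraMapInv : TensorAlgebra k V →ₐ[k] k) := by
      rw [TwoSidedIdeal.span_le]
      intro x hx
      simp only [Set.mem_iUnion, SetLike.mem_coe] at hx ⊢
      obtain ⟨s, hs, hx⟩ := hx
      rw [TwoSidedIdeal.mem_ker]
      exact algebraMapInv_eq_zero_of_mem_tpow (by have := P.two_le s hs; omega)
        (P.le_tpow s hs hx)
    intro x hx
    exact (TwoSidedIdeal.mem_ker _).1 (h (TwoSidedIdeal.mem_asIdeal.1 hx)))

/-- The homogeneous component
`I_n = ∑_{s ∈ S} ∑_{j = 0}^{n - s} V^{(j)} ⊗ R_s ⊗ V^{(n - s - j)}` of the ideal `⟨R⟩`. -/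
def I (n : ℤ) : Submodule k (TensorAlgebra k V) :=
  ∑ s ∈ S, ∑ j ∈ Finset.Icc (0 : ℤ) (n - s), tpow k V j * P.R s * tpow k V (n - s - j)

/-- `J̄_m^s = ⋂_{j = 0}^{m - s} V^{(j)} ⊗ R_s ⊗ V^{(m - s - j)}` if `m ≥ s`, and `V^{(m)}` if
`m < s`. -/
def Jbar (s : ℕ) (m : ℤ) : Submodule k (TensorAlgebra k V) :=
  if (s : ℤ) ≤ m then
    ⨅ j ∈ Finset.Icc (0 : ℤ) (m - s), tpow k V j * P.R s * tpow k V (m - s - j)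
  else tpow k V m

/-! ### The left multi-Koszul complex -/

/-- `J_0 = k`, `J_1 = V` and `J_i = ⨁_{s ∈ S} J̄^s_{n_s(i)}` for `i ≥ 2`. (The sum is direct since
the numbers `n_s(i)`, `s ∈ S`, are distinct.) -/
def J : ℕ → Submodule k (TensorAlgebra k V)
  | 0 => tpow k V 0
  | 1 => tpow k V 1
  | i + 2 => ∑ s ∈ S, P.Jbar s (nDeg s (i + 2))

/-- The `A`-linear map `A ⊗ T(V) → A ⊗ T(V)` with
`α ⊗ v₁ v₂ ⋯ vₙ ↦ α v₁ ⊗ v₂ ⋯ vₙ` for `n ≥ 1`, and `α ⊗ 1 ↦ 0`. -/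
def shift : P.Alg ⊗[k] TensorAlgebra k V →ₗ[P.Alg] P.Alg ⊗[k] TensorAlgebra k V :=
  TensorProduct.AlgebraTensorModule.lift
    (LinearMap.toSpanSingleton P.Alg (TensorAlgebra k V →ₗ[k] P.Alg ⊗[k] TensorAlgebra k V)
      (LinearMap.rTensor (TensorAlgebra k V) (P.proj.toLinearMap ∘ₗ TensorAlgebra.ι k) ∘ₗ
        firstLetter k V))

/-- The map `δ̂_i` on `A ⊗ T(V)`: for `i` odd it is `α ⊗ v₁ ⋯ vₙ ↦ α v₁ ⊗ v₂ ⋯ vₙ`; for `i` even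
it is `α ⊗ v₁ ⋯ vₙ ↦ α v₁ ⋯ v_{s - 1} ⊗ v_s ⋯ vₙ` on the component `A ⊗ V^{(n)}`, `n = n_s(i)`,
for each `s ∈ S`. -/
def deltaHat (i : ℕ) : P.Alg ⊗[k] TensorAlgebra k V →ₗ[P.Alg] P.Alg ⊗[k] TensorAlgebra k V :=
  if Odd i then P.shift
  else ∑ s ∈ S, (P.shift ^ (s - 1)) ∘ₗ LinearMap.baseChange P.Alg
    (GradedAlgebra.proj (fun n : ℕ => LinearMap.range (TensorAlgebra.ι k (M := V)) ^ n)
      (nDeg s i))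

/-- The `i`-th term `K(A)_i = A ⊗ J_i ⊆ A ⊗ T(V)` of the left multi-Koszul complex. -/
def K (i : ℕ) : Submodule P.Alg (P.Alg ⊗[k] TensorAlgebra k V) :=
  (P.J i).baseChange P.Alg

theorem shift_tmul (α : P.Alg) (v : V) (x : TensorAlgebra k V) :
    P.shift (α ⊗ₜ (TensorAlgebra.ι k v * x)) = (α * P.proj (TensorAlgebra.ι k v)) ⊗ₜ x := by
  simp [shift, firstLetter_ι_mul, TensorProduct.smul_tmul']

theorem shift_tmul_one (α : P.Alg) : P.shift (α ⊗ₜ 1) = 0 := by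
  simp [shift, firstLetter_one]

theorem map_baseChange_le {X Y : Submodule k (TensorAlgebra k V)}
    (f : P.Alg ⊗[k] TensorAlgebra k V →ₗ[P.Alg] P.Alg ⊗[k] TensorAlgebra k V)
    (h : ∀ x ∈ X, f (1 ⊗ₜ x) ∈ Y.baseChange P.Alg) {z : P.Alg ⊗[k] TensorAlgebra k V}
    (hz : z ∈ X.baseChange P.Alg) : f z ∈ Y.baseChange P.Alg := by
  have : X.baseChange P.Alg ≤ (Y.baseChange P.Alg).comap f := by
    rw [Submodule.baseChange_eq_span, Submodule.span_le]
    rintro _ ⟨x, hx, rfl⟩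
    exact h x hx
  exact this hz

theorem shift_mem {X : Submodule k (TensorAlgebra k V)} {x : TensorAlgebra k V}
    (hx : x ∈ tpow k V 1 * X) : P.shift (1 ⊗ₜ x) ∈ X.baseChange P.Alg := by
  have h1 : tpow k V 1 = LinearMap.range (TensorAlgebra.ι k (M := V)) := by
    simpa using tpow_natCast (k := k) (V := V) 1
  rw [h1] at hx
  refine Submodule.mul_induction_on hx ?_ ?_
  · rintro _ ⟨v, rfl⟩ y hy
    rw [shift_tmul]
    exact Submodule.tmul_mem_baseChange_of_mem _ hy
  · intro x y hx hy
    rw [TensorProduct.tmul_add, map_add]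
    exact add_mem hx hy

theorem shift_pow_mem {X : Submodule k (TensorAlgebra k V)} (c : ℕ) {x : TensorAlgebra k V}
    (hx : x ∈ tpow k V c * X) : (P.shift ^ c) (1 ⊗ₜ x) ∈ X.baseChange P.Alg := by
  induction c generalizing x X with
  | zero =>
    rw [tpow_natCast, pow_zero, one_mul] at hx
    exact Submodule.tmul_mem_baseChange_of_mem _ hx
  | succ c ih =>
    rw [Nat.cast_add, tpow_add (by positivity) (by positivity), mul_assoc] at hx
    rw [pow_succ', Module.End.mul_apply]
    exact P.map_baseChange_le P.shift (fun y hy => P.shift_mem hy) (ih hx)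

theorem mem_baseChange_biInf {ι : Type*} (s : Finset ι)
    (X : ι → Submodule k (TensorAlgebra k V)) {z : P.Alg ⊗[k] TensorAlgebra k V}
    (hz : ∀ j ∈ s, z ∈ (X j).baseChange P.Alg) : z ∈ (⨅ j ∈ s, X j).baseChange P.Alg := by
  classical
  let b := Module.Basis.ofVectorSpace k P.Alg
  have key : ∀ (Y : Submodule k (TensorAlgebra k V)), z ∈ Y.baseChange P.Alg →
      ∀ i, TensorProduct.equivFinsuppOfBasisLeft b z i ∈ Y := by
    clear hz
    rintro Y ⟨y, rfl⟩ i
    induction y using TensorProduct.induction_on with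
    | zero => simp
    | tmul α y =>
      rw [LinearMap.baseChange_tmul, TensorProduct.equivFinsuppOfBasisLeft_apply_tmul_apply]
      exact Y.smul_mem _ y.2
    | add y y' hy hy' =>
      rw [map_add, map_add, Finsupp.add_apply]
      exact Y.add_mem hy hy'
  rw [← (TensorProduct.equivFinsuppOfBasisLeft b).symm_apply_apply z,
    TensorProduct.equivFinsuppOfBasisLeft_symm_apply]
  refine Submodule.sum_mem _ fun i _ => Submodule.tmul_mem_baseChange_of_mem _ ?_
  simp only [Submodule.mem_iInf]
  exact fun j hj => key _ (hz j hj) i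

/-- `V^{(j)} = V^{(c)} ⊗ V^{(j - c)}` for `0 ≤ c ≤ j`. -/
theorem tpow_split {c j : ℤ} (hc : 0 ≤ c) (hj : c ≤ j) :
    tpow k V j = tpow k V c * tpow k V (j - c) := by
  rw [← tpow_add hc (by omega)]
  congr 1
  omega

theorem shift_pow_mem_Jbar {s : ℕ} (hs : s ∈ S) {m : ℤ} (c : ℕ) (hc : c ≤ s)
    (hm : (s : ℤ) ≤ m) (hmc : (s : ℤ) ≤ m - c ∨ m - c = 1) {x : TensorAlgebra k V}
    (hx : x ∈ P.Jbar s m) : (P.shift ^ c) (1 ⊗ₜ x) ∈ (P.Jbar s (m - c)).baseChange P.Alg := by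
  have h2 := P.two_le s hs
  rw [Jbar, if_pos hm] at hx
  simp only [Submodule.mem_iInf] at hx
  rw [Jbar]
  split_ifs with h
  · refine P.mem_baseChange_biInf _ _ fun j hj => P.shift_pow_mem c ?_
    rw [Finset.mem_Icc] at hj
    have := hx (j + c) (by rw [Finset.mem_Icc]; omega)
    rw [tpow_split (c := c) (by positivity) (show (c : ℤ) ≤ j + c by omega)] at this
    rw [← mul_assoc, ← mul_assoc]
    rwa [show j + c - c = j by omega, show m - s - (j + c) = m - c - s - j by omega] at this
  · have h1 : m - c = 1 := by omega
    refine P.shift_pow_mem c ?_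
    have h0 := hx 0 (by rw [Finset.mem_Icc]; omega)
    have hle : tpow k V 0 * P.R s * tpow k V (m - s - 0) ≤ tpow k V c * tpow k V (m - c) := by
      refine (mul_le_mul_left (mul_le_mul_right (P.le_tpow s hs) _) _).trans ?_
      rw [← tpow_add (by omega) (by omega), ← tpow_add (by omega) (by omega),
        ← tpow_add (by omega) (by omega)]
      apply le_of_eq
      congr 1
      omega
    exact hle h0

theorem Jbar_le_tpow {s : ℕ} (hs : s ∈ S) (m : ℤ) : P.Jbar s m ≤ tpow k V m := by
  rw [Jbar]
  split_ifs with h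
  · refine (biInf_le _ (show (0 : ℤ) ∈ Finset.Icc (0 : ℤ) (m - s) by
      rw [Finset.mem_Icc]; omega)).trans ?_
    refine (mul_le_mul_left (mul_le_mul_right (P.le_tpow s hs) _) _).trans ?_
    rw [← tpow_add (by omega) (by omega), ← tpow_add (by omega) (by omega)]
    apply le_of_eq
    congr 1
    omega
  · exact le_rfl

theorem sum_le {ι : Type*} (s : Finset ι) (X : ι → Submodule k (TensorAlgebra k V))
    (Y : Submodule k (TensorAlgebra k V)) (h : ∀ j ∈ s, X j ≤ Y) : ∑ j ∈ s, X j ≤ Y := by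
  classical
  induction s using Finset.induction_on with
  | empty => simp
  | insert j s hj ih =>
    rw [Finset.sum_insert hj, Submodule.add_eq_sup]
    exact sup_le (h j (Finset.mem_insert_self j s))
      (ih fun i hi => h i (Finset.mem_insert_of_mem hi))

theorem Jbar_le_J {s : ℕ} (hs : s ∈ S) (i : ℕ) : P.Jbar s (nDeg s i) ≤ P.J i := by
  have h2 := P.two_le s hs
  match i with
  | 0 => simpa [nDeg, J] using P.Jbar_le_tpow hs 0
  | 1 => simpa [nDeg, J] using P.Jbar_le_tpow hs 1
  | i + 2 =>
    rw [J, ← Finset.add_sum_erase S _ hs, Submodule.add_eq_sup]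
    exact le_sup_left

theorem le_nDeg (s : ℕ) {i : ℕ} (hi : 2 ≤ i) : s ≤ nDeg s i := by
  have h : 1 ≤ i / 2 := by omega
  unfold nDeg
  nlinarith [Nat.zero_le (i % 2)]

theorem nDeg_injective {s t i : ℕ} (hi : 2 ≤ i) (h : nDeg s i = nDeg t i) : s = t := by
  have h1 : 0 < i / 2 := by omega
  unfold nDeg at h
  exact Nat.eq_of_mul_eq_mul_right h1 (Nat.add_right_cancel h)

/-- For `i` even, `δ̂_i` is given on `A ⊗ J̄^s_{n_s(i)}` by
`α ⊗ v₁ ⋯ vₙ ↦ α v₁ ⋯ v_{s - 1} ⊗ v_s ⋯ vₙ`. -/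
theorem deltaHat_even {i : ℕ} (hi : ¬ Odd (i + 2)) {s : ℕ} (hs : s ∈ S)
    {x : TensorAlgebra k V} (hx : x ∈ P.Jbar s (nDeg s (i + 2))) :
    P.deltaHat (i + 2) (1 ⊗ₜ x) = (P.shift ^ (s - 1)) (1 ⊗ₜ x) := by
  have hx' := P.Jbar_le_tpow hs _ hx
  rw [tpow_natCast] at hx'
  rw [deltaHat, if_neg hi, LinearMap.sum_apply, Finset.sum_eq_single_of_mem s hs]
  · rw [LinearMap.comp_apply, LinearMap.baseChange_tmul, GradedAlgebra.proj_apply,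
      DirectSum.decompose_of_mem_same _ hx']
  · intro t _ hts
    rw [LinearMap.comp_apply, LinearMap.baseChange_tmul, GradedAlgebra.proj_apply,
      DirectSum.decompose_of_mem_ne _ hx'
        (fun h => hts (nDeg_injective (by omega) h).symm),
      TensorProduct.tmul_zero, map_zero]

theorem deltaHat_mem (i : ℕ) {z : P.Alg ⊗[k] TensorAlgebra k V} (hz : z ∈ P.K (i + 1)) :
    P.deltaHat (i + 1) z ∈ P.K i := by
  refine P.map_baseChange_le _ ?_ hz
  intro x hx
  obtain _ | i := i
  · have h1 : P.deltaHat 1 = P.shift := if_pos odd_one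
    have h2 : P.J 1 = tpow k V 1 * P.J 0 := by
      simp only [J]
      rw [← tpow_add (by omega) (by omega)]
      rfl
    rw [zero_add] at hx ⊢
    rw [h1]
    exact P.shift_mem (h2 ▸ hx)
  · suffices h : P.J (i + 2) ≤ (((P.J (i + 1)).baseChange P.Alg).restrictScalars k).comap
        ((P.deltaHat (i + 2)).restrictScalars k ∘ₗ TensorProduct.mk k P.Alg _ 1) from h hx
    refine sum_le S _ _ fun s hs y hy => ?_
    change P.deltaHat (i + 2) (1 ⊗ₜ y) ∈ (P.J (i + 1)).baseChange P.Alg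
    have hs2 := P.two_le s hs
    refine Submodule.baseChange_mono P.Alg (P.Jbar_le_J hs (i + 1)) ?_
    have hstep : ∃ c : ℕ, c ≤ s ∧ P.deltaHat (i + 2) (1 ⊗ₜ y) = (P.shift ^ c) (1 ⊗ₜ y) ∧
        (nDeg s (i + 1) : ℤ) = nDeg s (i + 2) - c := by
      by_cases hi : Odd (i + 2)
      · refine ⟨1, by omega, by rw [deltaHat, if_pos hi, pow_one], ?_⟩
        obtain ⟨l, hl⟩ := hi
        obtain rfl : i = 2 * (l - 1) + 1 := by omega
        simp only [nDeg]
        rw [show (2 * (l - 1) + 1 + 1) / 2 = l by omega,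
          show (2 * (l - 1) + 1 + 2) / 2 = l by omega,
          show (2 * (l - 1) + 1 + 1) % 2 = 0 by omega,
          show (2 * (l - 1) + 1 + 2) % 2 = 1 by omega]
        push_cast
        ring
      · refine ⟨s - 1, by omega, P.deltaHat_even hi hs hy, ?_⟩
        rw [Nat.not_odd_iff_even] at hi
        obtain ⟨l, hl⟩ := hi
        obtain rfl : i = 2 * (l - 1) := by omega
        simp only [nDeg]
        rw [show (2 * (l - 1) + 1) / 2 = l - 1 by omega,
          show (2 * (l - 1) + 2) / 2 = (l - 1) + 1 by omega,
          show (2 * (l - 1) + 1) % 2 = 1 by omega,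
          show (2 * (l - 1) + 2) % 2 = 0 by omega,
          Nat.cast_sub (show 1 ≤ s by omega)]
        push_cast
        ring
    obtain ⟨c, hc, hd, hn⟩ := hstep
    rw [hd, hn]
    refine P.shift_pow_mem_Jbar hs c hc ?_ ?_ hy
    · exact_mod_cast le_nDeg s (show 2 ≤ i + 2 by omega)
    · rw [← hn]
      obtain _ | i := i
      · right
        simp [nDeg]
      · left
        exact_mod_cast le_nDeg s (show 2 ≤ i + 1 + 1 by omega)

/-- The terms of the left multi-Koszul complex are free, hence projective, left `A`-modules. -/
theorem K_free (i : ℕ) : Module.Free P.Alg (P.K i) := by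
  have hinj : Function.Injective ((P.J i).subtype.baseChange P.Alg) :=
    Module.Flat.lTensor_preserves_injective_linearMap (M := P.Alg) (P.J i).subtype
      (P.J i).injective_subtype
  exact Module.Free.of_equiv (LinearEquiv.ofInjective _ hinj)

/-- The differential `δ_{i + 1} : K(A)_{i + 1} → K(A)_i`, the restriction of `δ̂_{i + 1}`. -/
def delta (i : ℕ) : P.K (i + 1) →ₗ[P.Alg] P.K i :=
  (P.deltaHat (i + 1)).restrict fun _ hz => P.deltaHat_mem i hz

/-- The augmentation `δ_0 : K(A)_0 = A ⊗ k = A → k`. -/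
def delta₀ : P.K 0 →ₗ[k] k :=
  LinearMap.mul' k k ∘ₗ TensorProduct.map P.augmentation.toLinearMap
    (TensorAlgebra.algebraMapInv (R := k) (M := V)).toLinearMap ∘ₗ
    (P.K 0).subtype.restrictScalars k

/-- `A` is (left) multi-Koszul: the augmented left multi-Koszul complex
`⋯ → K(A)_2 → K(A)_1 → K(A)_0 → k → 0` is exact, i.e. it is a projective resolution of the trivial
left `A`-module `k` (its terms are free by `K_free`). -/
def IsMultiKoszul : Prop :=
  Function.Surjective P.delta₀ ∧ Function.Exact (P.delta 0) P.delta₀ ∧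
    ∀ i : ℕ, Function.Exact (P.delta (i + 1)) (P.delta i)

end Presentation

/-! ### Distributivity and bidistributivity -/

section Lattice

variable {k W : Type*} [Field k] [AddCommGroup W] [Module k W]

/-- The sequence `(E, F_1, …, F_t)` of subspaces is distributive:
`E ∩ ∑ F_j = ∑ (E ∩ F_j)`. -/
def Distributive {t : ℕ} (E : Submodule k W) (F : Fin t → Submodule k W) : Prop :=
  E ⊓ (⨆ j, F j) = ⨆ j, E ⊓ F j

/-- The tuple `(E, E', F_1, …, F_t, G_1, …, G_{t'})` of subspaces is `(t, t')`-bidistributive: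
`E ∩ E' = 0` and `(E ⊕ E') ∩ (∑ F_j + ∑ G_j') = ∑ (E ∩ F_j) ⊕ ∑ (E' ∩ G_j')`. -/
def Bidistributive {t t' : ℕ} (E E' : Submodule k W) (F : Fin t → Submodule k W)
    (G : Fin t' → Submodule k W) : Prop :=
  E ⊓ E' = ⊥ ∧
    (E ⊔ E') ⊓ ((⨆ j, F j) ⊔ ⨆ j, G j) = (⨆ j, E ⊓ F j) ⊔ ⨆ j, E' ⊓ G j

end Lattice

/-! ### The lattice conditions for relations in two degrees `a < b` -/

namespace Presentation

variable {k V : Type*} [Field k] [AddCommGroup V] [Module k V] {S : Finset ℕ}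
  (P : Presentation k V S)

/-- The sum `∑_{j = l}^{u} V^{(j)} ⊗ R_s ⊗ V^{(m - s - j)}`, a subspace of `V^{(m)}`. -/
def sumR (s : ℕ) (m l u : ℤ) : Submodule k (TensorAlgebra k V) :=
  ∑ j ∈ Finset.Icc l u, tpow k V j * P.R s * tpow k V (m - s - j)

/-- The extra condition in degree `s`:
`(V^{(s-1)} ⊗ R_s) ∩ ∑_{j = 0}^{s - 2} V^{(j)} ⊗ R_s ⊗ V^{(s - 1 - j)} = V^{(s-2)} ⊗ J̄^s_{s+1}`. -/
def ExtraCondition (s : ℕ) : Prop :=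
  (tpow k V (s - 1) * P.R s) ⊓ P.sumR s (2 * s - 1) 0 (s - 2) =
    tpow k V (s - 2) * P.Jbar s (s + 1)

/-- `(2,2)`-bidistributivity, in degree `n`, of the tuple `(E', E'', F', G', F'', G'')`. -/
def BidistributiveAt (a b : ℕ) (n : ℤ) : Prop :=
  let E' := tpow k V (n - a) * P.R a
  let G' := P.sumR a n (n - 2 * a + 1) (n - a - 1)
  let F' := P.sumR a n 0 (n - 2 * a) + P.sumR b n 0 (n - a - b)
  let E'' := tpow k V (n - b) * P.R b
  let G'' := P.sumR b n (n - 2 * b + 1) (n - b - 1)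
  let F'' := P.sumR a n 0 (n - a - b) + P.sumR b n 0 (n - 2 * b)
  Bidistributive E' E'' ![F', G'] ![F'', G'']

/-- `E^s = V^{(n - n_s(i))} ⊗ J̄^s_{n_s(i)}`. -/
def E (s i : ℕ) (n : ℤ) : Submodule k (TensorAlgebra k V) :=
  tpow k V (n - nDeg s i) * P.Jbar s (nDeg s i)

/-- `F^s = I_{n - n_s(i)} ⊗ V^{(n_s(i))}`. -/
def F (s i : ℕ) (n : ℤ) : Submodule k (TensorAlgebra k V) :=
  P.I (n - nDeg s i) * tpow k V (nDeg s i)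

/-- `G^s_{s'} = ∑_{j = n - n_s(i) - s' + 1}^{n - n_s(i-1) - s'} V^{(j)} ⊗ R_{s'} ⊗ V^{(n-s'-j)}`. -/
def G (s s' i : ℕ) (n : ℤ) : Submodule k (TensorAlgebra k V) :=
  P.sumR s' n (n - nDeg s i - s' + 1) (n - nDeg s (i - 1) - s')

/-- Distributivity, in degree `n`, of the tuple `(E^s, F^s, G^s_a, G^s_b)`. -/
def DistributiveAt (a b s i : ℕ) (n : ℤ) : Prop :=
  Distributive (P.E s i n) ![P.F s i n, P.G s a i n, P.G s b i n]

/-- `X^{s,m}_{s'} = (V^{(m)} ⊗ R_s) ∩ ∑_{j = 0}^{m+s-s'-1} V^{(j)} ⊗ R_{s'} ⊗ V^{(m+s-s'-j)}`. -/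
def X (s s' : ℕ) (m : ℤ) : Submodule k (TensorAlgebra k V) :=
  (tpow k V m * P.R s) ⊓ P.sumR s' (m + s) 0 (m + s - s' - 1)

/-- The inclusion, for `i` even, in degree `n`:
`E^a ∩ (X^{a, n - n_a(i)}_b ⊗ V^{(n_a(i-2))})
  ⊆ V^{(n - n_a(i+1))} ⊗ J̄^a_{n_a(i+1)} + I_{n - n_a(i)} ⊗ J̄^a_{n_a(i)}`. -/
def EvenInclusion (a b i : ℕ) (n : ℤ) : Prop :=
  P.E a i n ⊓ (P.X a b (n - nDeg a i) * tpow k V (nDeg a (i - 2))) ≤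
    tpow k V (n - nDeg a (i + 1)) * P.Jbar a (nDeg a (i + 1)) +
      P.I (n - nDeg a i) * P.Jbar a (nDeg a i)

/-- The inclusion, for `i` odd:
`(V^{(b-1)} ⊗ J̄^a_{n_a(i)}) ∩ (((V^{(b-1)} ⊗ R_a) ∩ (R_b ⊗ V^{(a-1)})) ⊗ V^{(n_a(i-2))})
  ⊆ V^{(b-a)} ⊗ J̄^a_{n_a(i+1)} + I_{b-1} ⊗ J̄^a_{n_a(i)}`. -/
def OddInclusion (a b i : ℕ) : Prop :=
  (tpow k V (b - 1) * P.Jbar a (nDeg a i)) ⊓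
      (((tpow k V (b - 1) * P.R a) ⊓ (P.R b * tpow k V (a - 1))) * tpow k V (nDeg a (i - 2))) ≤
    tpow k V (b - a) * P.Jbar a (nDeg a (i + 1)) + P.I (b - 1) * P.Jbar a (nDeg a i)

end Presentation

end MultiKoszul

end

/-! The proof translates exactness of the complex into inclusions between subspaces of each
`V^{(n)}`, and then compares these inclusions with the lattice conditions.

Translation. An element of `A ⊗ J̄^s_{n_s(i)}` is represented by an element of `T(V) · J̄^s_{n_s(i)}
⊆ T(V)`: split off the last `n_s(i)` letters and project the remaining ones to `A` (`splitLast`). On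
representatives every differential is the identity, since it only moves the splitting point
(`deltaHat_splitLast`). The kernel of `splitLast` is `⟨R⟩ V^{(q)}` (`splitLast_eq_zero_iff`), so a
cycle is a representative lying in `⟨R⟩ V^{(n_s(i))}`, and a boundary is one lying in `T(V)
J̄^s_{n_s(i+2)} + ⟨R⟩ J̄^s_{n_s(i+1)}`. Exactness at the terms of index at most `1` is automatic.
From index `3` on the components for `a` and `b` do not interact, and exactness becomes `ExactAt`
for each `s` and each degree. At index `2` both components map to the same `A ⊗ V`, which gives the
joint condition `ExactAtTwo`. This is `isMultiKoszul_iff`.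

Comparison (`lattice_conditions_iff`). The sums in the distributive and bidistributive tuples are
exactly the spaces `I ⊗ V^{(q)}` that describe cycles (`F_sup_G_sup_G`, `sumR_sup_eq_I_mul_tpow`).
Distributivity therefore reduces exactness to the separate pieces `E ∩ F` and `E ∩ G`. The piece `E
∩ F` consists of boundaries, because it is contained in `I ⊗ J̄`. The piece `E^s ∩ G^s_s` is
controlled by the extra condition (`ExtraCondition.E_inf_G_le`), the piece `E^a ∩ G^a_b` by the even
and odd inclusions, and `E^b ∩ G^b_a` vanishes by minimality and bidistributivity
(`E_inf_G_eq_bot`).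

Conversely, exactness gives all the conditions directly, with one exception. The extra condition for
`a` is exactness in degree `2a - 1`, where the ideal contributes no error term. For `b` there may be
an error term in `I_{b-1} ⊗ R_b`, and `block_inf_sumR_le_of_exactAtTwo` removes it by pushing
relations to the left. -/

noncomputable section

namespace MultiKoszul

/-! ### Intersections of products of subspaces of `T(V)` -/

section TensorPowerLattice

variable {k V : Type*} [Field k] [AddCommGroup V] [Module k V]

variable (k V) in
/-- The reversal of words, as an algebra map to the opposite algebra. -/
def reverseHom : TensorAlgebra k V →ₐ[k] (TensorAlgebra k V)ᵐᵒᵖ :=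
  TensorAlgebra.lift k ((MulOpposite.opLinearEquiv k).toLinearMap ∘ₗ TensorAlgebra.ι k)

variable (k V) in
/-- The reversal of words `v₁ ⋯ vₙ ↦ vₙ ⋯ v₁`. -/
def reverse : TensorAlgebra k V →ₗ[k] TensorAlgebra k V :=
  (MulOpposite.opLinearEquiv k).symm.toLinearMap ∘ₗ (reverseHom k V).toLinearMap

theorem reverse_mul (x y : TensorAlgebra k V) :
    reverse k V (x * y) = reverse k V y * reverse k V x := by
  simp [reverse]

theorem reverse_ι (v : V) :
    reverse k V (TensorAlgebra.ι k v) = TensorAlgebra.ι k v := by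
  simp [reverse, reverseHom]

theorem reverse_reverse (x : TensorAlgebra k V) : reverse k V (reverse k V x) = x := by
  induction x using TensorAlgebra.induction with
  | algebraMap r => simp [reverse]
  | ι v => simp [reverse_ι]
  | mul x y hx hy => rw [reverse_mul, reverse_mul, hx, hy]
  | add x y hx hy => rw [map_add, map_add, hx, hy]

theorem reverse_mem_tpow {q : ℕ} {w : TensorAlgebra k V} (hw : w ∈ tpow k V q) :
    reverse k V w ∈ tpow k V q := by
  rw [tpow_natCast] at hw ⊢
  induction q generalizing w with
  | zero =>
    rw [pow_zero, Submodule.mem_one] at hw ⊢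
    obtain ⟨c, rfl⟩ := hw
    exact ⟨c, by simp [reverse]⟩
  | succ q ih =>
    rw [pow_succ] at hw
    rw [pow_succ']
    refine Submodule.mul_induction_on hw ?_ ?_
    · rintro x hx _ ⟨v, rfl⟩
      rw [reverse_mul, reverse_ι]
      exact Submodule.mul_mem_mul ⟨v, rfl⟩ (ih hx)
    · intro x y hx hy
      rw [map_add]
      exact add_mem hx hy

theorem tpow_mul_tpow {m n l : ℤ} (hm : 0 ≤ m) (hn : 0 ≤ n) (h : m + n = l) :
    tpow k V m * tpow k V n = tpow k V l := by
  rw [← h, tpow_add hm hn]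

theorem tpow_neg {n : ℤ} (hn : n < 0) : tpow k V n = ⊥ := if_pos hn

theorem tpow_zero : tpow k V 0 = 1 := by
  simpa using tpow_natCast (k := k) (V := V) 0

theorem tpow_one : tpow k V 1 = LinearMap.range (TensorAlgebra.ι k (M := V)) := by
  simpa using tpow_natCast (k := k) (V := V) 1

variable (k V) in
/-- The linear map splitting off the first `q` letters. -/
def splitLeft : ℕ → (TensorAlgebra k V →ₗ[k] TensorAlgebra k V ⊗[k] TensorAlgebra k V)
  | 0 => TensorProduct.mk k (TensorAlgebra k V) (TensorAlgebra k V) 1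
  | q + 1 => LinearMap.rTensor (TensorAlgebra k V) (LinearMap.mul' k (TensorAlgebra k V)) ∘ₗ
      (TensorProduct.assoc k _ _ _).symm.toLinearMap ∘ₗ
      TensorProduct.map (TensorAlgebra.ι k) (splitLeft q) ∘ₗ firstLetter k V

/-- This makes multiplication `V^{(q)} ⊗ T(V) → T(V)` injective, so that products of subspaces with
a homogeneous factor behave like tensor products. Bilinear maps descend to `T(V)` along it by
`factorLeft`, and by `factorRight` after reversing words. -/
theorem splitLeft_mul {q : ℕ} {w : TensorAlgebra k V} (hw : w ∈ tpow k V q)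
    (u : TensorAlgebra k V) : splitLeft k V q (w * u) = w ⊗ₜ u := by
  rw [tpow_natCast] at hw
  induction q generalizing w with
  | zero =>
    rw [pow_zero, Submodule.mem_one] at hw
    obtain ⟨c, rfl⟩ := hw
    simp [splitLeft, Algebra.algebraMap_eq_smul_one, TensorProduct.smul_tmul]
  | succ q ih =>
    rw [pow_succ'] at hw
    refine Submodule.mul_induction_on hw ?_ ?_
    · rintro _ ⟨v, rfl⟩ x hx
      simp [splitLeft, mul_assoc, firstLetter_ι_mul, ih hx]
    · intro x y hx hy
      rw [add_mul, map_add, hx, hy, TensorProduct.add_tmul]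

section Factor

variable {W : Type*} [AddCommGroup W] [Module k W]

/-- The linear map with `w * u ↦ B w u` for `w` of degree `q`. -/
def factorLeft (q : ℕ) (B : TensorAlgebra k V →ₗ[k] TensorAlgebra k V →ₗ[k] W) :
    TensorAlgebra k V →ₗ[k] W :=
  TensorProduct.lift B ∘ₗ splitLeft k V q

theorem factorLeft_mul {q : ℕ} (B : TensorAlgebra k V →ₗ[k] TensorAlgebra k V →ₗ[k] W)
    {w : TensorAlgebra k V} (hw : w ∈ tpow k V q) (u : TensorAlgebra k V) :
    factorLeft q B (w * u) = B w u := by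
  simp [factorLeft, splitLeft_mul hw]

/-- The linear map with `u * w ↦ B u w` for `w` of degree `q`. -/
def factorRight (q : ℕ) (B : TensorAlgebra k V →ₗ[k] TensorAlgebra k V →ₗ[k] W) :
    TensorAlgebra k V →ₗ[k] W :=
  factorLeft q (B.flip.compl₁₂ (reverse k V) (reverse k V)) ∘ₗ reverse k V

theorem factorRight_mul {q : ℕ} (B : TensorAlgebra k V →ₗ[k] TensorAlgebra k V →ₗ[k] W)
    {w : TensorAlgebra k V} (hw : w ∈ tpow k V q) (u : TensorAlgebra k V) :
    factorRight q B (u * w) = B u w := by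
  simp [factorRight, reverse_mul, factorLeft_mul _ (reverse_mem_tpow hw), reverse_reverse]

end Factor

/-- A linear map which fixes `X` and maps `Y` into `X ⊓ Y`. -/
theorem exists_projection {W : Type*} [AddCommGroup W] [Module k W] (X Y : Submodule k W) :
    ∃ g : W →ₗ[k] W, (∀ x ∈ X, g x = x) ∧ (∀ y ∈ Y, g y ∈ X ⊓ Y) ∧ ∀ y, g y ∈ X := by
  obtain ⟨N, hN⟩ := Submodule.exists_isCompl (X ⊓ Y)
  have hd : Disjoint X (Y ⊓ N) := by
    rw [disjoint_iff, ← inf_assoc]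
    exact hN.inf_eq_bot
  -- By modularity `Y = (X ⊓ Y) ⊕ (Y ⊓ N)`. The complement `C` of `X` is chosen to contain `Y ⊓ N`,
  -- so projecting along `C` sends `Y` into `X ⊓ Y`.
  obtain ⟨C, hC, hXC⟩ := hd.symm.exists_isCompl
  refine ⟨X.projection C hXC.symm, fun x hx => ?_, fun y hy => ?_, fun y => ?_⟩
  · simpa using Submodule.projection_apply_left hXC.symm ⟨x, hx⟩
  · have hy' : y ∈ X ⊓ Y ⊔ N ⊓ Y := by
      rw [← sup_inf_assoc_of_le _ inf_le_right, hN.sup_eq_top, top_inf_eq]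
      exact hy
    obtain ⟨p, hp, r, hr, rfl⟩ := Submodule.mem_sup.1 hy'
    rw [map_add, show X.projection C hXC.symm p = p from
      Submodule.projection_apply_left hXC.symm ⟨p, hp.1⟩,
      Submodule.projection_apply_of_mem_right hXC.symm (hC ⟨hr.2, hr.1⟩), add_zero]
    exact hp
  · exact Submodule.projection_apply_mem hXC.symm y

variable {X Y Z : Submodule k (TensorAlgebra k V)}

theorem mul_le_of_map {W : Type*} [AddCommGroup W] [Module k W] (F : TensorAlgebra k V →ₗ[k] W)
    {U : Submodule k W} (h : ∀ x ∈ X, ∀ y ∈ Y, F (x * y) ∈ U) : ∀ z ∈ X * Y, F z ∈ U := by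
  intro z hz
  refine Submodule.mul_induction_on hz h ?_
  intro x y hx hy
  rw [map_add]
  exact add_mem hx hy

theorem eqOn_mul {W : Type*} [AddCommGroup W] [Module k W] {F F' : TensorAlgebra k V →ₗ[k] W}
    (h : ∀ x ∈ X, ∀ y ∈ Y, F (x * y) = F' (x * y)) : ∀ z ∈ X * Y, F z = F' z := by
  intro z hz
  refine Submodule.mul_induction_on hz h ?_
  intro x y hx hy
  rw [map_add, map_add, hx, hy]

/-- Tensoring over a field is exact. Concretely, `id ⊗ g` with `g` from `exists_projection` fixes
`V^{(c)} X` and maps `V^{(c)} Y` into `V^{(c)} (X ⊓ Y)`. -/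
theorem tpow_mul_inf (c : ℤ) (X Y : Submodule k (TensorAlgebra k V)) :
    tpow k V c * (X ⊓ Y) = tpow k V c * X ⊓ tpow k V c * Y := by
  refine le_antisymm (le_inf (mul_le_mul_right inf_le_left _) (mul_le_mul_right inf_le_right _)) ?_
  by_cases hc : c < 0
  · simp [tpow_neg hc]
  lift c to ℕ using not_lt.1 hc
  rintro z ⟨hzX, hzY⟩
  obtain ⟨g, hg, hgY, -⟩ := exists_projection X Y
  let F := factorLeft c ((LinearMap.mul k (TensorAlgebra k V)).compl₂ g)
  have h1 : F z = z := eqOn_mul (F' := LinearMap.id) (fun w hw u hu => by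
    simp [F, factorLeft_mul _ hw, hg u hu]) z hzX
  rw [← h1]
  exact mul_le_of_map F (fun w hw u hu => by
    simpa [F, factorLeft_mul _ hw] using Submodule.mul_mem_mul hw (hgY u hu)) z hzY

theorem inf_mul_tpow (c : ℤ) (X Y : Submodule k (TensorAlgebra k V)) :
    (X ⊓ Y) * tpow k V c = X * tpow k V c ⊓ Y * tpow k V c := by
  refine le_antisymm (le_inf (mul_le_mul_left inf_le_left _) (mul_le_mul_left inf_le_right _)) ?_
  by_cases hc : c < 0
  · simp [tpow_neg hc]
  lift c to ℕ using not_lt.1 hc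
  rintro z ⟨hzX, hzY⟩
  obtain ⟨g, hg, hgY, -⟩ := exists_projection X Y
  let F := factorRight c ((LinearMap.mul k (TensorAlgebra k V)).comp g)
  have h1 : F z = z := eqOn_mul (F' := LinearMap.id) (fun u hu w hw => by
    simp [F, factorRight_mul _ hw, hg u hu]) z hzX
  rw [← h1]
  exact mul_le_of_map F (fun u hu w hw => by
    simpa [F, factorRight_mul _ hw] using Submodule.mul_mem_mul (hgY u hu) hw) z hzY

/-- Projecting the left factor onto `X` fixes `X V^{(c)}` and sends `Z Y` into `X Y`. This is how a
cycle whose last letters lie in `J̄` and whose first letters are a relation is recognised as an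
element of `I ⊗ J̄`. -/
theorem mul_inf_mul_le_of_le_tpow {c : ℤ} (hY : Y ≤ tpow k V c) :
    Z * Y ⊓ X * tpow k V c ≤ X * Y := by
  by_cases hc : c < 0
  · simp [tpow_neg hc]
  lift c to ℕ using not_lt.1 hc
  rintro z ⟨hzY, hzX⟩
  obtain ⟨g, hg, -, hgX⟩ := exists_projection X X
  let F := factorRight c ((LinearMap.mul k (TensorAlgebra k V)).comp g)
  have h1 : F z = z := eqOn_mul (F' := LinearMap.id) (fun u hu w hw => by
    simp [F, factorRight_mul _ hw, hg u hu]) z hzX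
  rw [← h1]
  exact mul_le_of_map F (fun u hu w hw => by
    simpa [F, factorRight_mul _ (hY hw)] using Submodule.mul_mem_mul (hgX u) hw) z hzY

/-- Contract the first `c` letters with the multiplicative extension `φ` of a functional `f` with `f
v ≠ 0`. It does not vanish on `v ^ c`, so `v ^ c * x` is sent to a nonzero multiple of `x`. -/
theorem le_of_tpow_mul_le [Nontrivial V] {c : ℤ} (hc : 0 ≤ c)
    (h : tpow k V c * X ≤ tpow k V c * Y) : X ≤ Y := by
  lift c to ℕ using hc
  obtain ⟨v, hv⟩ := exists_ne (0 : V)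
  obtain ⟨f, hf⟩ := not_forall.1 (mt (Module.forall_dual_apply_eq_zero_iff k v).1 hv)
  let φ := TensorAlgebra.lift k f
  let w := TensorAlgebra.ι k v ^ c
  have hw : w ∈ tpow k V c := by
    rw [tpow_natCast]
    exact Submodule.pow_mem_pow _ (LinearMap.mem_range_self _ v) c
  have hφ : φ w ≠ 0 := by simpa [φ, w] using pow_ne_zero c hf
  let F := factorLeft c ((LinearMap.lsmul k (TensorAlgebra k V)).comp φ.toLinearMap)
  intro x hx
  have h1 : F (w * x) ∈ Y := mul_le_of_map F (fun y hy z hz => by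
    simpa [F, factorLeft_mul _ hy] using Y.smul_mem _ hz) _ (h (Submodule.mul_mem_mul hw hx))
  rw [factorLeft_mul _ hw] at h1
  exact (Y.smul_mem_iff hφ).1 h1

end TensorPowerLattice

theorem iSup_cons_two {α : Type*} [CompleteLattice α] (x y : α) :
    ⨆ j, (![x, y] : Fin 2 → α) j = x ⊔ y := by
  refine le_antisymm (iSup_le fun j => ?_) (sup_le ?_ ?_)
  · fin_cases j
    · exact le_sup_left
    · exact le_sup_right
  · exact le_iSup (![x, y] : Fin 2 → α) 0
  · exact le_iSup (![x, y] : Fin 2 → α) 1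

theorem iSup_cons_three {α : Type*} [CompleteLattice α] (x y z : α) :
    ⨆ j, (![x, y, z] : Fin 3 → α) j = x ⊔ y ⊔ z := by
  refine le_antisymm (iSup_le fun j => ?_) (sup_le (sup_le ?_ ?_) ?_)
  · fin_cases j
    · exact le_sup_left.trans le_sup_left
    · exact le_sup_right.trans le_sup_left
    · exact le_sup_right
  · exact le_iSup (![x, y, z] : Fin 3 → α) 0
  · exact le_iSup (![x, y, z] : Fin 3 → α) 1
  · exact le_iSup (![x, y, z] : Fin 3 → α) 2

theorem nDeg_two (s : ℕ) : nDeg s 2 = s := by simp [nDeg]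

theorem nDeg_three (s : ℕ) : nDeg s 3 = s + 1 := by simp [nDeg]

theorem nDeg_add_two (s i : ℕ) : nDeg s (i + 2) = nDeg s i + s := by
  simp only [nDeg, Nat.add_mod_right, Nat.add_div_right i (show 0 < 2 by omega)]
  ring

theorem nDeg_succ_of_even (s : ℕ) {i : ℕ} (hi : Even i) : nDeg s (i + 1) = nDeg s i + 1 := by
  obtain ⟨l, rfl⟩ := hi
  simp only [nDeg]
  rw [show (l + l + 1) / 2 = l by omega, show (l + l) / 2 = l by omega,
    show (l + l + 1) % 2 = 1 by omega, show (l + l) % 2 = 0 by omega]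

theorem nDeg_succ_of_odd (s : ℕ) {i : ℕ} (hi : Odd i) :
    nDeg s (i + 1) + 1 = nDeg s i + s := by
  rw [← nDeg_succ_of_even s hi.add_one, nDeg_add_two]

/-! ### Calculus of the subspaces `V^{(i)} ⊗ R_s ⊗ V^{(j)}` and their sums -/

namespace Presentation

variable {k V : Type*} [Field k] [AddCommGroup V] [Module k V] {S : Finset ℕ}
  (P : Presentation k V S)

/-- The subspace `V^{(i)} ⊗ R_s ⊗ V^{(j)}`. -/
def block (s : ℕ) (i j : ℤ) : Submodule k (TensorAlgebra k V) :=
  tpow k V i * P.R s * tpow k V j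

variable {P} {s : ℕ} {c i j l u m n : ℤ} {Y : Submodule k (TensorAlgebra k V)}

theorem block_of_left_neg (hi : i < 0) : P.block s i j = ⊥ := by simp [block, tpow_neg hi]

theorem block_of_right_neg (hj : j < 0) : P.block s i j = ⊥ := by simp [block, tpow_neg hj]

theorem tpow_mul_block (hc : 0 ≤ c) (hi : 0 ≤ i) (h : c + i = l) :
    tpow k V c * P.block s i j = P.block s l j := by
  rw [block, ← mul_assoc, ← mul_assoc, tpow_mul_tpow hc hi h, block]

theorem block_mul_tpow (hj : 0 ≤ j) (hc : 0 ≤ c) (h : j + c = l) :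
    P.block s i j * tpow k V c = P.block s i l := by
  rw [block, mul_assoc, tpow_mul_tpow hj hc h, block]

theorem tpow_mul_block_le (h : c + i = l) : tpow k V c * P.block s i j ≤ P.block s l j := by
  by_cases hc : c < 0
  · simp [tpow_neg hc]
  by_cases hi : i < 0
  · simp [block_of_left_neg hi]
  exact (tpow_mul_block (not_lt.1 hc) (not_lt.1 hi) h).le

theorem block_mul_tpow_le (h : j + c = l) : P.block s i j * tpow k V c ≤ P.block s i l := by
  by_cases hc : c < 0
  · simp [tpow_neg hc]
  by_cases hj : j < 0
  · simp [block_of_right_neg hj]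
  exact (block_mul_tpow (not_lt.1 hj) (not_lt.1 hc) h).le

theorem tpow_mul_R : tpow k V i * P.R s = P.block s i 0 := by
  rw [block, tpow_zero, mul_one]

theorem R_mul_tpow : P.R s * tpow k V j = P.block s 0 j := by
  rw [block, tpow_zero, one_mul]

theorem R_eq_block : P.R s = P.block s 0 0 := by
  rw [← tpow_mul_R, tpow_zero, one_mul]

theorem block_le_tpow (hs : s ∈ S) (h : i + s + j = n) : P.block s i j ≤ tpow k V n := by
  by_cases hi : i < 0
  · simp [block_of_left_neg hi]
  by_cases hj : j < 0
  · simp [block_of_right_neg hj]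
  rw [← tpow_mul_tpow (show 0 ≤ i + s by omega) (not_lt.1 hj) h,
    ← tpow_mul_tpow (not_lt.1 hi) (show 0 ≤ (s : ℤ) by omega) rfl]
  exact mul_le_mul_left (mul_le_mul_right (P.le_tpow s hs) _) _

theorem le_sum {ι : Type*} {t : Finset ι} {X : ι → Submodule k (TensorAlgebra k V)} {e : ι}
    (he : e ∈ t) : X e ≤ ∑ j ∈ t, X j := by
  classical
  rw [← Finset.add_sum_erase t _ he, Submodule.add_eq_sup]
  exact le_sup_left

/-- The bounds `l` and `u` may leave the interval `[0, m - s]`, where the terms vanish because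
`V^{(n)} = 0` for `n < 0`. This is why the bounds of the tuples need no truncation in low degrees.
-/
theorem sumR_le (h : ∀ j, l ≤ j → j ≤ u → 0 ≤ j → j ≤ m - s → P.block s j (m - s - j) ≤ Y) :
    P.sumR s m l u ≤ Y := by
  refine Presentation.sum_le _ _ _ fun j hj => ?_
  rw [Finset.mem_Icc] at hj
  change P.block s j (m - s - j) ≤ Y
  by_cases h0 : j < 0
  · simp [block_of_left_neg h0]
  by_cases h1 : m - s < j
  · rw [block_of_right_neg (by omega)]
    exact bot_le
  exact h j hj.1 hj.2 (by omega) (by omega)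

theorem block_le_sumR (h : i + s + j = m) (h1 : l ≤ i) (h2 : i ≤ u) :
    P.block s i j ≤ P.sumR s m l u := by
  rw [show j = m - s - i by omega]
  exact le_sum (X := fun i => P.block s i (m - s - i)) (Finset.mem_Icc.2 ⟨h1, h2⟩)

theorem sumR_mono {l' u' : ℤ} (hl : 0 ≤ l → l' ≤ l) (hl' : l < 0 → l' ≤ 0) (hu : u ≤ u') :
    P.sumR s m l u ≤ P.sumR s m l' u' :=
  sumR_le fun j _ _ _ _ => block_le_sumR (by omega) (by omega) (by omega)

theorem tpow_mul_sumR_le {m' l' u' : ℤ} (hm : m + c = m') (hl : l' ≤ l + c) (hu : u + c ≤ u') :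
    tpow k V c * P.sumR s m l u ≤ P.sumR s m' l' u' := by
  rw [sumR, Finset.mul_sum]
  refine Presentation.sum_le _ _ _ fun j hj => ?_
  rw [Finset.mem_Icc] at hj
  exact (tpow_mul_block_le (l := c + j) rfl).trans
    (block_le_sumR (by omega) (by omega) (by omega))

theorem sumR_mul_tpow_le {m' l' u' : ℤ} (hm : m + c = m') (hl : l' ≤ l) (hu : u ≤ u') :
    P.sumR s m l u * tpow k V c ≤ P.sumR s m' l' u' := by
  rw [sumR, Finset.sum_mul]
  refine Presentation.sum_le _ _ _ fun j hj => ?_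
  rw [Finset.mem_Icc] at hj
  exact (block_mul_tpow_le (P := P) (l := m - s - j + c) rfl).trans
    (block_le_sumR (by omega) (by omega) (by omega))

theorem sumR_le_tpow_mul {m' l' u' : ℤ} (hc : 0 ≤ c) (hm : m' + c = m) (hcl : c ≤ l)
    (hl : l' + c ≤ l) (hu : u ≤ u' + c) : P.sumR s m l u ≤ tpow k V c * P.sumR s m' l' u' := by
  refine sumR_le fun j h1 h2 h3 _ => ?_
  rw [← tpow_mul_block (i := j - c) hc (by omega) (by omega)]
  exact mul_le_mul_right (block_le_sumR (by omega) (by omega) (by omega)) _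

theorem sumR_le_mul_tpow {m' l' u' : ℤ} (hc : 0 ≤ c) (hm : m' + c = m) (hl : l' ≤ l)
    (hu : u ≤ u') (hum : u ≤ m' - s) : P.sumR s m l u ≤ P.sumR s m' l' u' * tpow k V c := by
  refine sumR_le fun j h1 h2 h3 _ => ?_
  rw [← block_mul_tpow (j := m' - s - j) (by omega) hc (by omega)]
  exact mul_le_mul_left (block_le_sumR (by omega) (by omega) (by omega)) _

theorem sumR_eq_bot (h : u < 0 ∨ u < l) : P.sumR s m l u = ⊥ := by
  rw [eq_bot_iff]
  exact sumR_le fun j _ _ _ _ => by omega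

theorem sumR_le_I (hs : s ∈ S) : P.sumR s m l u ≤ P.I m :=
  (sumR_le fun _ _ _ h1 h2 => block_le_sumR (by omega) h1 h2).trans
    (le_sum (X := fun s => P.sumR s m 0 (m - s)) hs)

theorem I_le (h : ∀ s ∈ S, P.sumR s n 0 (n - s) ≤ Y) : P.I n ≤ Y :=
  Presentation.sum_le _ _ _ h

theorem block_le_I (hs : s ∈ S) (h : i + s + j = n) : P.block s i j ≤ P.I n :=
  (block_le_sumR h le_rfl le_rfl).trans (sumR_le_I hs)

theorem tpow_mul_I_le (h : c + m = n) : tpow k V c * P.I m ≤ P.I n := by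
  rw [I, Finset.mul_sum]
  refine Presentation.sum_le _ _ _ fun s hs => ?_
  exact (tpow_mul_sumR_le (P := P) (by omega) le_rfl le_rfl).trans (sumR_le_I hs)

theorem I_mul_tpow_le (h : m + c = n) : P.I m * tpow k V c ≤ P.I n := by
  rw [I, Finset.sum_mul]
  refine Presentation.sum_le _ _ _ fun s hs => ?_
  exact (sumR_mul_tpow_le (P := P) (by omega) le_rfl le_rfl).trans (sumR_le_I hs)

theorem I_mul_tpow_le_I_mul_tpow {m' c' : ℤ} (hc : 0 ≤ c') (hm : m ≤ m') (h : m + c = m' + c') :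
    P.I m * tpow k V c ≤ P.I m' * tpow k V c' := by
  rw [← tpow_mul_tpow (show 0 ≤ m' - m by omega) hc (show _ = c by omega), ← mul_assoc]
  exact mul_le_mul_left (I_mul_tpow_le (by omega)) _

theorem sumR_le_I_mul_tpow (hs : s ∈ S) (hc : 0 ≤ c) (h : n + c = m) (hu : u ≤ n - s) :
    P.sumR s m l u ≤ P.I n * tpow k V c :=
  (sumR_le_mul_tpow hc h le_rfl le_rfl hu).trans (mul_le_mul_left (sumR_le_I hs) _)

theorem I_le_tpow : P.I n ≤ tpow k V n :=
  I_le fun s hs => sumR_le fun j _ _ _ _ => block_le_tpow hs (by omega)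

theorem I_eq_bot {a : ℕ} (ha : ∀ s ∈ S, a ≤ s) (h : n < a) : P.I n = ⊥ := by
  rw [eq_bot_iff]
  exact I_le fun s hs => (sumR_eq_bot (by have := ha s hs; omega)).le

/-! ### The spaces `J̄` -/

theorem Jbar_le_block (hs : s ≤ m) (h : i + s + j = m) (hi : 0 ≤ i) (hj : 0 ≤ j) :
    P.Jbar s m ≤ P.block s i j := by
  rw [Jbar, if_pos hs, show j = m - s - i by omega]
  exact iInf₂_le (f := fun i _ => P.block s i (m - s - i)) i
    (Finset.mem_Icc.2 ⟨hi, by omega⟩)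

theorem le_Jbar (hs : s ≤ m) (h : ∀ j, 0 ≤ j → j ≤ m - s → Y ≤ P.block s j (m - s - j)) :
    Y ≤ P.Jbar s m := by
  rw [Jbar, if_pos hs]
  refine le_iInf₂ fun j hj => ?_
  rw [Finset.mem_Icc] at hj
  exact h j hj.1 hj.2

theorem Jbar_self : P.Jbar s s = P.R s := by
  rw [R_eq_block]
  refine le_antisymm (Jbar_le_block le_rfl (by omega) le_rfl le_rfl) (le_Jbar le_rfl ?_)
  intro j h1 h2
  obtain rfl : j = 0 := by omega
  simp

theorem tpow_mul_Jbar_le_block {q r : ℤ} (hs : s ≤ q) (h1 : m ≤ r)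
    (h : r + s + j = m + q) (hj : 0 ≤ j) : tpow k V m * P.Jbar s q ≤ P.block s r j := by
  by_cases hm : m < 0
  · simp [tpow_neg hm]
  exact (mul_le_mul_right (Jbar_le_block hs (i := r - m) (j := j) (by omega) (by omega) hj) _).trans
    (tpow_mul_block_le (by omega))

/-- Among the conditions defining `J̄_{m+1}`, only the one at position `0` is not already part of `V
⊗ J̄_m`. -/
theorem tpow_one_mul_Jbar_inf_le (hs : s ≤ m) :
    tpow k V 1 * P.Jbar s m ⊓ P.block s 0 (m + 1 - s) ≤ P.Jbar s (m + 1) := by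
  refine le_Jbar (by omega) fun j h1 h2 => ?_
  obtain rfl | hj := h1.eq_or_lt
  · rw [sub_zero]
    exact inf_le_right
  · exact inf_le_left.trans (tpow_mul_Jbar_le_block hs (by omega) (by omega) (by omega))

/-- The term `tpow k V c * ⊤` is there for the empty intersection, at which the induction starts. -/
theorem tpow_mul_top_inf_biInf_le {ι : Type*} (t : Finset ι)
    (X : ι → Submodule k (TensorAlgebra k V)) :
    tpow k V c * ⊤ ⊓ ⨅ j ∈ t, tpow k V c * X j ≤ tpow k V c * ⨅ j ∈ t, X j := by
  classical
  induction t using Finset.induction_on with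
  | empty => simp
  | insert e t he ih =>
    rw [Finset.iInf_insert, Finset.iInf_insert, tpow_mul_inf]
    exact le_inf (inf_le_right.trans inf_le_left)
      ((inf_le_inf_left _ inf_le_right).trans ih)

theorem Jbar_le_tpow_mul_Jbar {q : ℤ} (hc : 0 ≤ c) (hs : s ≤ q) (h : q + c = m) :
    P.Jbar s m ≤ tpow k V c * P.Jbar s q := by
  refine le_trans (le_inf ?_ (le_iInf₂ fun j hj => ?_)) ((tpow_mul_top_inf_biInf_le _ _).trans_eq
    (congrArg _ (if_pos hs).symm))
  · refine (Jbar_le_block (i := c) (j := q - s) (by omega) (by omega) hc (by omega)).trans ?_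
    rw [block, mul_assoc]
    exact mul_le_mul_right le_top _
  · rw [Finset.mem_Icc] at hj
    refine (Jbar_le_block (i := c + j) (j := q - s - j) (by omega) (by omega) (by omega)
      (by omega)).trans ?_
    exact (tpow_mul_block (P := P) hc hj.1 rfl).ge

theorem tpow_mul_Jbar_le_tpow_mul_Jbar {q q' : ℤ} (hs : s ≤ q) (hq : q ≤ q') (h : m + q' = n + q) :
    tpow k V m * P.Jbar s q' ≤ tpow k V n * P.Jbar s q := by
  by_cases hm : m < 0
  · simp [tpow_neg hm]
  rw [← tpow_mul_tpow (not_lt.1 hm) (show 0 ≤ q' - q by omega) (show _ = n by omega), mul_assoc]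
  exact mul_le_mul_right (Jbar_le_tpow_mul_Jbar (by omega) hs (by omega)) _

end Presentation

namespace Presentation

variable {k V : Type*} [Field k] [AddCommGroup V] [Module k V] {S : Finset ℕ}
  {P : Presentation k V S} {s : ℕ} {c i j l u m n : ℤ}

/-! ### Consequences of the extra condition -/

/-- The extra condition is the case `c = s - 1`. A smaller `c` follows by multiplying with
`V^{(s-1-c)}` on the left and cancelling, which requires `V ≠ 0`; for `V = 0` there are no
relations. -/
theorem ExtraCondition.tpow_mul_R_inf_sumR_le (h : P.ExtraCondition s) (hs : s ∈ S)
    (hc : c ≤ s - 1) :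
    P.block s c 0 ⊓ P.sumR s (c + s) 0 (c - 1) ≤ tpow k V (c - 1) * P.Jbar s (s + 1) := by
  have hs2 := P.two_le s hs
  obtain hc0 | hc0 := le_or_gt c 0
  · rw [sumR_eq_bot (by omega), inf_bot_eq]
    exact bot_le
  cases subsingleton_or_nontrivial V with
  | inl hV =>
    have h0 : tpow k V s = ⊥ := by
      rw [tpow_natCast, ← Nat.sub_add_cancel (show 1 ≤ s by omega), pow_succ]
      rw [show TensorAlgebra.ι k (M := V) = 0 from LinearMap.ext fun v => by
        rw [Subsingleton.elim v 0, map_zero, map_zero], LinearMap.range_zero, Submodule.mul_bot]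
    have h1 : P.R s = ⊥ := le_bot_iff.1 (h0 ▸ P.le_tpow s hs)
    simp [block, h1]
  | inr hV =>
    refine le_of_tpow_mul_le (c := s - 1 - c) (by omega) ?_
    rw [tpow_mul_inf, tpow_mul_block (l := s - 1) (by omega) (by omega) (by omega), ← mul_assoc,
      tpow_mul_tpow (l := s - 2) (by omega) (by omega) (by omega), ← h, ← tpow_mul_R]
    exact inf_le_inf_left _ (tpow_mul_sumR_le (by omega) (by omega) (by omega))

/-- Relations starting at most `s - 1` letters before position `m` do not involve the first `m - s +
1` letters. Splitting these off leads back to the extra condition itself; if `m ≤ s - 1`, the case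
of small `c` applies directly. -/
theorem ExtraCondition.block_inf_sumR_le (h : P.ExtraCondition s) (hs : s ∈ S) (hn : m + s = n)
    (hl : m - s + 1 ≤ l) (hu : u ≤ m - 1) :
    P.block s m 0 ⊓ P.sumR s n l u ≤ tpow k V (m - 1) * P.Jbar s (s + 1) := by
  have hs2 := P.two_le s hs
  subst hn
  obtain hm | hm := le_or_gt m (s - 1)
  · refine le_trans (inf_le_inf_left _ ?_) (h.tpow_mul_R_inf_sumR_le hs hm)
    exact sumR_le fun j _ _ _ _ => block_le_sumR (by omega) (by omega) (by omega)
  · rw [← tpow_mul_block (c := m - s + 1) (i := s - 1) (l := m) (by omega) (by omega) (by omega),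
      ← tpow_mul_tpow (m := m - s + 1) (n := s - 2) (l := m - 1) (by omega) (by omega) (by omega),
      mul_assoc, ← h, tpow_mul_inf, tpow_mul_R]
    exact inf_le_inf_left _
      (sumR_le_tpow_mul (by omega) (by omega) (by omega) (by omega) (by omega))

/-- Two overlapping copies of `R_s` force all the copies between them. The extra condition moves the
right copy one position to the left, so the last letter becomes free and can be split off, and the
induction continues with the remaining letters. -/
theorem ExtraCondition.block_inf_block_le (h : P.ExtraCondition s) (hs : s ∈ S) {c j : ℕ}
    (hc : c + 1 ≤ s) (hj : j ≤ c) : P.block s c 0 ⊓ P.block s 0 c ≤ P.block s j (c - j) := by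
  induction c with
  | zero =>
    obtain rfl : j = 0 := by omega
    simp
  | succ c ih =>
    obtain rfl | hj := hj.eq_or_lt
    · simp
    · have h1 : P.block s (c + 1) 0 ⊓ P.block s 0 (c + 1) ≤ P.block s c 1 :=
        (le_trans (inf_le_inf_left _ (block_le_sumR (by omega) le_rfl (by omega)))
          (h.tpow_mul_R_inf_sumR_le hs (by omega))).trans
            (tpow_mul_Jbar_le_block (by omega) (by omega) (by omega) (by omega))
      have h2 : P.block s (c + 1) 0 ⊓ P.block s 0 (c + 1) ≤
          (P.block s c 0 ⊓ P.block s 0 c) * tpow k V 1 := by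
        rw [inf_mul_tpow, block_mul_tpow (l := 1) (by omega) (by omega) (by omega),
          block_mul_tpow (l := c + 1) (by omega) (by omega) (by omega)]
        exact le_inf h1 inf_le_right
      push_cast
      refine (h2.trans (mul_le_mul_left (ih (by omega) (by omega)) _)).trans ?_
      exact block_mul_tpow_le (by omega)

/-- The copies of `R_s` in the window of `G^s_s` overlap the first copy of `R_s` in `J̄`, so the
extra condition extends `J̄` to the left as far as the next term of the complex requires. -/
theorem ExtraCondition.E_inf_G_le (h : P.ExtraCondition s) (hs : s ∈ S) {i : ℕ} (hi : 1 ≤ i) :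
    P.E s (i + 1) n ⊓ P.G s s (i + 1) n ≤
      tpow k V (n - nDeg s (i + 2)) * P.Jbar s (nDeg s (i + 2)) := by
  have hs2 := P.two_le s hs
  have h1 := le_nDeg s (show 2 ≤ i + 1 by omega)
  have h2 := nDeg_add_two s i
  rw [E, G, Nat.add_sub_cancel]
  obtain hi' | hi' := i.even_or_odd
  · have h3 := nDeg_succ_of_even s hi'
    generalize nDeg s i = q' at *
    generalize nDeg s (i + 1) = q at *
    generalize nDeg s (i + 2) = q'' at *
    subst h2 h3
    obtain hp | hp := lt_or_ge (n - q' - s) 0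
    · rw [sumR_eq_bot (by omega), inf_bot_eq]
      exact bot_le
    -- For `i` even the window is a single position, `s - 1` letters to the left of `J̄`.
    have hG : P.sumR s n (n - (q' + 1 : ℕ) - s + 1) (n - q' - s) ≤
        tpow k V (n - (q' + s : ℕ)) * P.block s 0 q' := by
      rw [tpow_mul_block (by omega) (by omega) rfl]
      refine sumR_le fun j h4 h5 _ _ => ?_
      rw [show j = n - (q' + s : ℕ) + 0 by omega]
      exact le_of_eq (by congr 1; omega)
    have hE : tpow k V (n - (q' + 1 : ℕ)) * P.Jbar s (q' + 1 : ℕ) =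
        tpow k V (n - (q' + s : ℕ)) * (tpow k V (s - 1) * P.Jbar s (q' + 1 : ℕ)) := by
      rw [← mul_assoc, tpow_mul_tpow (l := n - (q' + 1 : ℕ)) (by omega) (by omega) (by omega)]
    refine (inf_le_inf hE.le hG).trans ?_
    rw [← tpow_mul_inf]
    refine mul_le_mul_right (le_Jbar (by omega) fun j h4 h5 => ?_) _
    -- Positions from `s - 1` on are supplied by `J̄`. The earlier ones lie between the copies of
    -- `R_s` at `0` and at `s - 1`.
    obtain hj | hj := le_or_gt (s - 1 : ℤ) j
    · exact inf_le_left.trans (tpow_mul_Jbar_le_block (by omega) hj (by omega) (by omega))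
    · lift j to ℕ using h4
      have h6 : tpow k V (s - 1) * P.Jbar s (q' + 1 : ℕ) ≤
          P.block s (s - 1 : ℕ) 0 * tpow k V (q' + 1 - s) := by
        rw [block_mul_tpow le_rfl (by omega) rfl]
        exact tpow_mul_Jbar_le_block (by omega) (by omega) (by omega) (by omega)
      have h7 : P.block s 0 q' = P.block s 0 (s - 1 : ℕ) * tpow k V (q' + 1 - s) := by
        rw [block_mul_tpow (l := q') (by omega) (by omega) (by omega)]
      rw [h7]
      refine (inf_le_inf_right _ h6).trans ?_
      rw [← inf_mul_tpow]
      exact (mul_le_mul_left (h.block_inf_block_le hs (by omega) (by omega)) _).trans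
        (block_mul_tpow_le (by omega))
  · have h3 := nDeg_succ_of_odd s hi'
    generalize nDeg s i = q' at *
    generalize nDeg s (i + 1) = q at *
    generalize nDeg s (i + 2) = q'' at *
    obtain hm | hm := lt_or_ge (n - q) 1
    · rw [sumR_eq_bot (by omega), inf_bot_eq]
      exact bot_le
    have hE : tpow k V (n - q) * P.Jbar s q ≤ P.block s (n - q) 0 * tpow k V (q - s) := by
      rw [block_mul_tpow le_rfl (by omega) rfl]
      exact tpow_mul_Jbar_le_block (by omega) (by omega) (by omega) (by omega)
    have hG : P.sumR s n (n - q - s + 1) (n - q' - s) ≤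
        P.sumR s (n - q + s) (n - q - s + 1) (n - q - 1) * tpow k V (q - s) :=
      sumR_le_mul_tpow (by omega) (by omega) (by omega) (by omega) (by omega)
    -- For `i` odd the window has `s - 1` positions and `J̄` must grow by one letter only. The extra
    -- condition, applied to the first copy of `R_s` in `J̄`, supplies the copy one position further
    -- to the left.
    have h4 : tpow k V (n - q) * P.Jbar s q ⊓ P.sumR s n (n - q - s + 1) (n - q' - s) ≤
        P.block s (n - q - 1) (q + 1 - s) := by
      refine (inf_le_inf hE hG).trans ?_
      rw [← inf_mul_tpow]
      refine (mul_le_mul_left ((h.block_inf_sumR_le hs rfl le_rfl le_rfl).trans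
        (tpow_mul_Jbar_le_block (r := n - q - 1) (j := 1) (by omega) (by omega) (by omega)
          (by omega))) _).trans ?_
      exact block_mul_tpow_le (by omega)
    refine (le_inf inf_le_left h4).trans ?_
    rw [← tpow_mul_tpow (m := n - q - 1) (n := 1) (l := n - q) (by omega) (by omega) (by omega),
      mul_assoc, ← tpow_mul_block (c := n - q - 1) (i := 0) (by omega) le_rfl (by omega),
      ← tpow_mul_inf, show n - (q'' : ℤ) = n - q - 1 by omega, show (q'' : ℤ) = q + 1 by omega]
    exact mul_le_mul_right (tpow_one_mul_Jbar_inf_le (by omega)) _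

end Presentation

/-! ### Exactness in a single degree and the tuples `(E, F, G, G)` -/

namespace Presentation

variable {k V : Type*} [Field k] [AddCommGroup V] [Module k V] {S : Finset ℕ}

/-- Exactness in degree `n` of the `s`-component of the multi-Koszul complex at its term of
index `i + 1`, in terms of subspaces of `V^{(n)}`. -/
def ExactAt (P : Presentation k V S) (s i : ℕ) (n : ℤ) : Prop :=
  tpow k V (n - nDeg s (i + 1)) * P.Jbar s (nDeg s (i + 1)) ⊓
      P.I (n - nDeg s i) * tpow k V (nDeg s i) ≤
    tpow k V (n - nDeg s (i + 2)) * P.Jbar s (nDeg s (i + 2)) ⊔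
      P.I (n - nDeg s (i + 1)) * P.Jbar s (nDeg s (i + 1))

/-- Exactness in degree `n` of the multi-Koszul complex at its term of index `2`, in terms of
subspaces of `V^{(n)}`. -/
def ExactAtTwo (P : Presentation k V S) (a b : ℕ) (n : ℤ) : Prop :=
  ∀ x ∈ P.block a (n - a) 0, ∀ y ∈ P.block b (n - b) 0, x + y ∈ P.I (n - 1) * tpow k V 1 →
    x ∈ tpow k V (n - a - 1) * P.Jbar a (a + 1) ⊔ P.I (n - a) * P.R a ∧
    y ∈ tpow k V (n - b - 1) * P.Jbar b (b + 1) ⊔ P.I (n - b) * P.R b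

variable {a b : ℕ} {P : Presentation k V {a, b}} {s i : ℕ} {n : ℤ}

theorem mem_pair_left : a ∈ ({a, b} : Finset ℕ) := Finset.mem_insert_self a {b}

theorem mem_pair_right : b ∈ ({a, b} : Finset ℕ) :=
  Finset.mem_insert_of_mem (Finset.mem_singleton_self b)

theorem nDeg_le_nDeg_succ (hs : 2 ≤ s) (i : ℕ) : nDeg s i ≤ nDeg s (i + 1) := by
  obtain hi | hi := i.even_or_odd
  · have := nDeg_succ_of_even s hi; omega
  · have := nDeg_succ_of_odd s hi; omega

/-- Relations that leave the last `n_s(i)` letters free either leave the last `n_s(i+1)` letters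
free, and are collected in `F`, or end in between, and are collected in `G`. Hence the sum in the
distributivity condition is the space cutting out the cycles. -/
theorem F_sup_G_sup_G (hs : 2 ≤ s) :
    P.F s (i + 1) n ⊔ P.G s a (i + 1) n ⊔ P.G s b (i + 1) n =
      P.I (n - nDeg s i) * tpow k V (nDeg s i) := by
  have hq := nDeg_le_nDeg_succ hs i
  have hab : ∀ t ∈ ({a, b} : Finset ℕ), P.F s (i + 1) n ⊔ P.G s t (i + 1) n ≤
      P.F s (i + 1) n ⊔ P.G s a (i + 1) n ⊔ P.G s b (i + 1) n := by
    intro t ht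
    obtain rfl | rfl : t = a ∨ t = b := by simpa using ht
    · exact le_sup_left
    · exact sup_le (le_sup_left.trans le_sup_left) le_sup_right
  have hG : ∀ t ∈ ({a, b} : Finset ℕ), P.G s t (i + 1) n ≤
      P.I (n - nDeg s i) * tpow k V (nDeg s i) := by
    intro t ht
    rw [G, Nat.add_sub_cancel]
    exact sumR_le_I_mul_tpow ht (by omega) (by omega) (by omega)
  refine le_antisymm (sup_le (sup_le ?_ (hG a mem_pair_left)) (hG b mem_pair_right)) ?_
  · exact I_mul_tpow_le_I_mul_tpow (by omega) (by omega) (by omega)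
  · rw [I, Finset.sum_mul]
    refine Presentation.sum_le _ _ _ fun t ht => le_trans ?_ (hab t ht)
    refine (sumR_mul_tpow_le (P := P) (m' := n) (u' := n - nDeg s i - t) (by omega) le_rfl
      le_rfl).trans ?_
    refine sumR_le fun j h1 h2 h3 h4 => ?_
    obtain hj | hj := le_or_gt j (n - nDeg s (i + 1) - t)
    · refine le_trans ?_ le_sup_left
      rw [F, ← block_mul_tpow (j := n - t - j - nDeg s (i + 1)) (c := nDeg s (i + 1)) (by omega)
        (by omega) (by omega)]
      exact mul_le_mul_left (block_le_I ht (by omega)) _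
    · refine le_trans ?_ le_sup_right
      rw [G, Nat.add_sub_cancel]
      exact block_le_sumR (by omega) (by omega) (by omega)

theorem distributiveAt_iff (hs : 2 ≤ s) :
    P.DistributiveAt a b s (i + 1) n ↔
      P.E s (i + 1) n ⊓ P.I (n - nDeg s i) * tpow k V (nDeg s i) ≤
        P.E s (i + 1) n ⊓ P.F s (i + 1) n ⊔ P.E s (i + 1) n ⊓ P.G s a (i + 1) n ⊔
          P.E s (i + 1) n ⊓ P.G s b (i + 1) n := by
  have h : ∀ j, P.E s (i + 1) n ⊓ ![P.F s (i + 1) n, P.G s a (i + 1) n, P.G s b (i + 1) n] j =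
      ![P.E s (i + 1) n ⊓ P.F s (i + 1) n, P.E s (i + 1) n ⊓ P.G s a (i + 1) n,
        P.E s (i + 1) n ⊓ P.G s b (i + 1) n] j := fun j => by fin_cases j <;> rfl
  rw [DistributiveAt, Distributive, iSup_congr h, iSup_cons_three, iSup_cons_three,
    F_sup_G_sup_G hs]
  refine ⟨le_of_eq, fun h' => le_antisymm h' ?_⟩
  rw [← F_sup_G_sup_G hs]
  exact sup_le (sup_le (inf_le_inf_left _ (le_sup_left.trans le_sup_left))
    (inf_le_inf_left _ (le_sup_right.trans le_sup_left))) (inf_le_inf_left _ le_sup_right)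

theorem E_inf_F_le (hs : s ∈ S) {P : Presentation k V S} :
    P.E s i n ⊓ P.F s i n ≤ P.I (n - nDeg s i) * P.Jbar s (nDeg s i) :=
  mul_inf_mul_le_of_le_tpow (P.Jbar_le_tpow hs _)

/-! ### Exactness implies the lattice conditions -/

/-- The two kinds of boundaries already lie in single pieces: `J̄^s_{n_s(i+2)}` starts with a copy
of `R_s` in the window of `G^s_s`, and `I ⊗ J̄` lies in `E ⊓ F`. -/
theorem ExactAt.distributiveAt (h : P.ExactAt s i n) (hs : s ∈ ({a, b} : Finset ℕ)) (hi : 1 ≤ i) :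
    P.DistributiveAt a b s (i + 1) n := by
  have hs2 := P.two_le s hs
  have h1 := le_nDeg s (show 2 ≤ i + 1 by omega)
  have h2 := nDeg_add_two s i
  have h3 := nDeg_le_nDeg_succ hs2 i
  have h4 : nDeg s (i + 1) ≤ nDeg s (i + 2) := nDeg_le_nDeg_succ hs2 (i + 1)
  have hq : nDeg s (i + 2) + 1 ≤ nDeg s (i + 1) + s := by
    obtain hi | hi := i.even_or_odd
    · have := nDeg_succ_of_even s hi; omega
    · have := nDeg_succ_of_odd s hi; omega
  rw [distributiveAt_iff hs2]
  have hE : tpow k V (n - nDeg s (i + 2)) * P.Jbar s (nDeg s (i + 2)) ≤ P.E s (i + 1) n :=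
    tpow_mul_Jbar_le_tpow_mul_Jbar (by omega) (by omega) (by omega)
  have hG : tpow k V (n - nDeg s (i + 2)) * P.Jbar s (nDeg s (i + 2)) ≤ P.G s s (i + 1) n := by
    rw [G, Nat.add_sub_cancel]
    refine (tpow_mul_Jbar_le_block (r := n - nDeg s (i + 2)) (j := nDeg s i) (by omega) (by omega)
      (by omega) (by omega)).trans (block_le_sumR (by omega) (by omega) (by omega))
  refine h.trans (sup_le ?_ ?_)
  · obtain rfl | rfl : s = a ∨ s = b := by simpa using hs
    · exact (le_inf hE hG).trans (le_sup_right.trans le_sup_left)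
    · exact (le_inf hE hG).trans le_sup_right
  · exact (le_inf (mul_le_mul_left (I_le_tpow) _)
      (mul_le_mul_right (P.Jbar_le_tpow hs _) _)).trans (le_sup_left.trans le_sup_left)

/-- The relations `R_b` entering `X` leave one letter free. Together with the `n_a(i-1)` letters
behind them these are the `n_a(i)` free letters of a cycle, since `i - 1` is even. -/
theorem ExactAt.evenInclusion (h : P.ExactAt a i n) (hi : Odd i) :
    P.EvenInclusion a b (i + 1) n := by
  refine le_trans (inf_le_inf_left _ ?_) h
  have h1 := nDeg_succ_of_odd a hi
  obtain ⟨i, rfl⟩ : ∃ j, i = j + 1 := ⟨i - 1, by have := hi.pos; omega⟩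
  have h2 := nDeg_succ_of_even a (i := i) (by rwa [Nat.odd_add_one, Nat.not_odd_iff_even] at hi)
  rw [show i + 1 + 1 - 2 = i by omega]
  refine (mul_le_mul_left inf_le_right _).trans ?_
  refine (sumR_mul_tpow_le (m' := n) (by omega) le_rfl le_rfl).trans ?_
  exact sumR_le_I_mul_tpow mem_pair_right (by omega) (by omega) (by omega)

/-- In the degree `n_a(i+1) + b - 1` the relation `R_b` occupies the first `b` letters, and exactly
`n_a(i)` letters remain behind it. -/
theorem ExactAt.oddInclusion (h : P.ExactAt a i (nDeg a (i + 1) + b - 1)) (hi : Even i)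
    (hi2 : 2 ≤ i) (ha : 2 ≤ a) : P.OddInclusion a b (i + 1) := by
  have h1 := nDeg_succ_of_even a hi
  obtain ⟨i, rfl⟩ : ∃ j, i = j + 1 := ⟨i - 1, by omega⟩
  have h2 := nDeg_succ_of_odd a (i := i) (by rwa [Nat.even_add_one, Nat.not_even_iff_odd] at hi)
  have h3 := nDeg_add_two a (i + 1)
  rw [ExactAt] at h
  rw [OddInclusion, show i + 1 + 1 - 2 = i by omega, Submodule.add_eq_sup]
  simp only [
    show ((nDeg a (i + 1 + 1) : ℕ) : ℤ) + b - 1 - (nDeg a (i + 1 + 1) : ℕ) = b - 1 by omega,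
    show ((nDeg a (i + 1 + 1) : ℕ) : ℤ) + b - 1 - (nDeg a (i + 1) : ℕ) = b by omega,
    show ((nDeg a (i + 1 + 1) : ℕ) : ℤ) + b - 1 - (nDeg a (i + 1 + 2) : ℕ) = b - a by omega] at h
  refine le_trans (inf_le_inf_left _ ?_) h
  refine (mul_le_mul_left inf_le_right _).trans ?_
  rw [mul_assoc, tpow_mul_tpow (by omega) (by omega) (show _ = (nDeg a (i + 1) : ℤ) by omega),
    R_eq_block]
  exact mul_le_mul_left (block_le_I mem_pair_right (by omega)) _

end Presentation

/-! ### Bidistributivity, the extra conditions and exactness at index two -/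

namespace Presentation

variable {k V : Type*} [Field k] [AddCommGroup V] [Module k V]
  {a b : ℕ} {P : Presentation k V {a, b}} {s i : ℕ} {m n : ℤ}

/-- Together the four sums contain every relation that does not touch the last letter, and nothing
else. -/
theorem sumR_sup_eq_I_mul_tpow (ha : 2 ≤ a) (hab : a < b) :
    (P.sumR a n 0 (n - 2 * a) + P.sumR b n 0 (n - a - b)) ⊔
        P.sumR a n (n - 2 * a + 1) (n - a - 1) ⊔
      ((P.sumR a n 0 (n - a - b) + P.sumR b n 0 (n - 2 * b)) ⊔
        P.sumR b n (n - 2 * b + 1) (n - b - 1)) = P.I (n - 1) * tpow k V 1 := by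
  simp only [Submodule.add_eq_sup]
  have hA {l u : ℤ} (hu : u ≤ n - a - 1) : P.sumR a n l u ≤ P.I (n - 1) * tpow k V 1 :=
    sumR_le_I_mul_tpow mem_pair_left (by omega) (by omega) (by omega)
  have hB {l u : ℤ} (hu : u ≤ n - b - 1) : P.sumR b n l u ≤ P.I (n - 1) * tpow k V 1 :=
    sumR_le_I_mul_tpow mem_pair_right (by omega) (by omega) (by omega)
  refine le_antisymm (sup_le (sup_le (sup_le (hA ?_) (hB ?_)) (hA ?_))
    (sup_le (sup_le (hA ?_) (hB ?_)) (hB ?_))) ?_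
  any_goals omega
  rw [I, Finset.sum_mul]
  refine Presentation.sum_le _ _ _ fun t ht => ?_
  refine (sumR_mul_tpow_le (P := P) (m' := n) (by omega) le_rfl le_rfl).trans ?_
  obtain rfl | rfl : t = a ∨ t = b := by simpa using ht
  · refine le_trans (sumR_le fun j h1 h2 _ _ => ?_) le_sup_left
    obtain hj | hj := le_or_gt j (n - 2 * t)
    · exact (block_le_sumR (by omega) h1 hj).trans (le_sup_left.trans le_sup_left)
    · exact (block_le_sumR (by omega) (by omega) (by omega)).trans le_sup_right
  · refine le_trans (sumR_le fun j h1 h2 _ _ => ?_) le_sup_right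
    obtain hj | hj := le_or_gt j (n - 2 * t)
    · exact (block_le_sumR (by omega) h1 hj).trans (le_sup_right.trans le_sup_left)
    · exact (block_le_sumR (by omega) (by omega) (by omega)).trans le_sup_right

theorem R_inf_sumR (hab : a < b) : P.R b ⊓ P.sumR a b 0 (b - a) = ⊥ := by
  rw [eq_bot_iff, ← P.minimal b mem_pair_right]
  exact inf_le_inf_left _ (le_sum (X := fun t : ℕ => P.sumR t b 0 (b - t))
    (Finset.mem_filter.2 ⟨mem_pair_left, hab⟩))

/-- This is minimality after splitting off the common factor `V^{(n)}`. -/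
theorem block_inf_block_eq_bot (hab : a < b) (h : m + a = n + b) :
    P.block a m 0 ⊓ P.block b n 0 = ⊥ := by
  obtain hn | hn := lt_or_ge n 0
  · rw [block_of_left_neg hn, inf_bot_eq]
  rw [← tpow_mul_block (c := n) (i := b - a) (l := m) hn (by omega) (by omega),
    ← tpow_mul_block (P := P) (c := n) (i := 0) (l := n) hn (by omega) (by omega), ← tpow_mul_inf,
    ← R_eq_block, inf_comm, eq_bot_iff]
  refine (mul_le_mul_right ((inf_le_inf_left _ ?_).trans_eq (R_inf_sumR hab)) _).trans_eq
    (Submodule.mul_bot _)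
  exact block_le_sumR (by omega) (by omega) le_rfl

theorem I_mul_R_le : P.I m * P.R s ≤ P.block s m 0 := by
  rw [← tpow_mul_R]
  exact mul_le_mul_left I_le_tpow _

/-- The intersections of the terms of the tuple `(E', E'', F', G', F'', G'')`. -/
theorem inf_F_le (hs : s ∈ ({a, b} : Finset ℕ)) :
    P.block s (n - s) 0 ⊓ (P.sumR a n 0 (n - s - a) + P.sumR b n 0 (n - s - b)) ≤
      P.I (n - s) * P.R s := by
  have h : P.sumR a n 0 (n - s - a) + P.sumR b n 0 (n - s - b) ≤ P.I (n - s) * tpow k V s :=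
    sup_le (sumR_le_I_mul_tpow mem_pair_left (by omega) (by omega) le_rfl)
      (sumR_le_I_mul_tpow mem_pair_right (by omega) (by omega) le_rfl)
  refine (inf_le_inf_left _ h).trans ?_
  rw [← tpow_mul_R]
  exact mul_inf_mul_le_of_le_tpow (P.le_tpow s hs)

theorem le_inf_F (hs : s ∈ ({a, b} : Finset ℕ)) :
    P.I (n - s) * P.R s ≤
      P.block s (n - s) 0 ⊓ (P.sumR a n 0 (n - s - a) + P.sumR b n 0 (n - s - b)) := by
  refine le_inf I_mul_R_le ((mul_le_mul_right (P.le_tpow s hs) _).trans ?_)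
  rw [I, Finset.sum_mul]
  refine Presentation.sum_le _ _ _ fun t ht => ?_
  refine (sumR_mul_tpow_le (P := P) (m' := n) (by omega) le_rfl le_rfl).trans ?_
  obtain rfl | rfl : t = a ∨ t = b := by simpa using ht
  · exact le_sup_left
  · exact le_sup_right

/-- `E' ⊓ E'' = ⊥` always holds by minimality, `E' ⊓ F'` and `E'' ⊓ F''` are `I_{n-a} ⊗ R_a` and
`I_{n-b} ⊗ R_b`, and one of the two inclusions is automatic. What remains concerns the cycles at
index two. -/
theorem bidistributiveAt_iff (ha : 2 ≤ a) (hab : a < b) :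
    P.BidistributiveAt a b n ↔
      (P.block a (n - a) 0 ⊔ P.block b (n - b) 0) ⊓ P.I (n - 1) * tpow k V 1 ≤
        (P.I (n - a) * P.R a ⊔
          P.block a (n - a) 0 ⊓ P.sumR a n (n - 2 * a + 1) (n - a - 1)) ⊔
        (P.I (n - b) * P.R b ⊔
          P.block b (n - b) 0 ⊓ P.sumR b n (n - 2 * b + 1) (n - b - 1)) := by
  have h2 (E x y : Submodule k (TensorAlgebra k V)) (j : Fin 2) :
      E ⊓ (![x, y] : Fin 2 → _) j = (![E ⊓ x, E ⊓ y] : Fin 2 → _) j := by fin_cases j <;> rfl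
  have hFa : P.block a (n - a) 0 ⊓ (P.sumR a n 0 (n - 2 * a) + P.sumR b n 0 (n - a - b)) =
      P.I (n - a) * P.R a := by
    rw [show n - 2 * a = n - a - a by ring]
    exact le_antisymm (inf_F_le mem_pair_left) (le_inf_F mem_pair_left)
  have hFb : P.block b (n - b) 0 ⊓ (P.sumR a n 0 (n - a - b) + P.sumR b n 0 (n - 2 * b)) =
      P.I (n - b) * P.R b := by
    rw [show n - 2 * b = n - b - b by ring, show n - a - b = n - b - a by ring]
    exact le_antisymm (inf_F_le mem_pair_right) (le_inf_F mem_pair_right)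
  simp only [BidistributiveAt, Bidistributive, h2, iSup_cons_two]
  rw [sumR_sup_eq_I_mul_tpow ha hab, tpow_mul_R, tpow_mul_R, hFa, hFb]
  refine ⟨fun h => h.2.le, fun h => ⟨block_inf_block_eq_bot hab (by omega), le_antisymm h ?_⟩⟩
  have hI {t : ℕ} (ht : t ∈ ({a, b} : Finset ℕ)) (h1 : 1 ≤ t) :
      P.I (n - t) * P.R t ≤ P.I (n - 1) * tpow k V 1 :=
    (mul_le_mul_right (P.le_tpow t ht) _).trans
      (I_mul_tpow_le_I_mul_tpow (by omega) (by omega) (by omega))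
  refine sup_le (sup_le ?_ ?_) (sup_le ?_ ?_)
  · exact le_inf (I_mul_R_le.trans le_sup_left) (hI mem_pair_left (by omega))
  · exact le_inf (inf_le_left.trans le_sup_left) (inf_le_right.trans
      (sumR_le_I_mul_tpow mem_pair_left (by omega) (by omega) (by omega)))
  · exact le_inf (I_mul_R_le.trans le_sup_right) (hI mem_pair_right (by omega))
  · exact le_inf (inf_le_left.trans le_sup_right) (inf_le_right.trans
      (sumR_le_I_mul_tpow mem_pair_right (by omega) (by omega) (by omega)))

theorem tpow_mul_Jbar_succ_le (hs : 2 ≤ s) :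
    tpow k V (m - 1) * P.Jbar s (s + 1) ≤
      P.block s m 0 ⊓ P.sumR s (m + s) (m - s + 1) (m - 1) :=
  le_inf (tpow_mul_Jbar_le_block (by omega) (by omega) (by omega) le_rfl)
    ((tpow_mul_Jbar_le_block (by omega) (r := m - 1) (j := 1) le_rfl (by omega) (by omega)).trans
      (block_le_sumR (by omega) (by omega) le_rfl))

theorem ExactAtTwo.bidistributiveAt (h : P.ExactAtTwo a b n) (ha : 2 ≤ a) (hab : a < b) :
    P.BidistributiveAt a b n := by
  rw [bidistributiveAt_iff ha hab]
  rintro z ⟨hz, hzI⟩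
  obtain ⟨x, hx, y, hy, rfl⟩ := Submodule.mem_sup.1 hz
  obtain ⟨hx', hy'⟩ := h x hx y hy hzI
  refine add_mem (Submodule.mem_sup_left ?_) (Submodule.mem_sup_right ?_)
  · refine (sup_le (le_sup_of_le_right ?_) le_sup_left : _ ≤ (_ : Submodule _ _)) hx'
    refine (tpow_mul_Jbar_succ_le ha).trans_eq ?_
    congr 2 <;> ring
  · refine (sup_le (le_sup_of_le_right ?_) le_sup_left : _ ≤ (_ : Submodule _ _)) hy'
    refine (tpow_mul_Jbar_succ_le (by omega)).trans_eq ?_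
    congr 2 <;> ring

theorem exactAtTwo_of_bidistributiveAt (h : P.BidistributiveAt a b n) (ha : 2 ≤ a) (hab : a < b)
    (hea : P.ExtraCondition a) (heb : P.ExtraCondition b) : P.ExactAtTwo a b n := by
  intro x hx y hy hxy
  rw [bidistributiveAt_iff ha hab] at h
  obtain ⟨p, hp, q, hq, hpq⟩ := Submodule.mem_sup.1
    (h ⟨Submodule.mem_sup.2 ⟨x, hx, y, hy, rfl⟩, hxy⟩)
  have hp' := (sup_le I_mul_R_le inf_le_left : _ ≤ (_ : Submodule _ _)) hp
  have hq' := (sup_le I_mul_R_le inf_le_left : _ ≤ (_ : Submodule _ _)) hq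
  -- The decompositions `x + y = p + q` agree because the sum of `E'` and `E''` is direct.
  have h0 : x - p ∈ P.block a (n - a) 0 ⊓ P.block b (n - b) 0 := by
    refine ⟨sub_mem hx hp', ?_⟩
    rw [show x - p = q - y by rw [sub_eq_sub_iff_add_eq_add, ← hpq, add_comm]]
    exact sub_mem hq' hy
  rw [block_inf_block_eq_bot hab (by omega), Submodule.mem_bot, sub_eq_zero] at h0
  subst h0
  obtain rfl : q = y := add_left_cancel hpq
  refine ⟨(sup_le le_sup_right (le_sup_of_le_left ?_) : _ ≤ (_ : Submodule _ _)) hp,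
    (sup_le le_sup_right (le_sup_of_le_left ?_) : _ ≤ (_ : Submodule _ _)) hq⟩
  · exact hea.block_inf_sumR_le mem_pair_left (by omega) (by omega) (by omega)
  · exact heb.block_inf_sumR_le mem_pair_right (by omega) (by omega) (by omega)

theorem extraCondition_iff (hs : 2 ≤ s) :
    P.ExtraCondition s ↔
      P.block s (s - 1) 0 ⊓ P.sumR s (2 * s - 1) 0 (s - 2) ≤
        tpow k V (s - 2) * P.Jbar s (s + 1) := by
  rw [ExtraCondition, tpow_mul_R]
  refine ⟨le_of_eq, fun h => le_antisymm h ?_⟩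
  have := tpow_mul_Jbar_succ_le (P := P) (m := s - 1) hs
  rw [show (s : ℤ) - 1 - 1 = s - 2 by ring, show (s : ℤ) - 1 + s = 2 * s - 1 by ring,
    show (s : ℤ) - 1 - s + 1 = 0 by ring] at this
  exact this

theorem ExactAtTwo.left (h : P.ExactAtTwo a b n) :
    P.block a (n - a) 0 ⊓ P.I (n - 1) * tpow k V 1 ≤
      tpow k V (n - a - 1) * P.Jbar a (a + 1) ⊔ P.I (n - a) * P.R a :=
  fun x hx => (h x hx.1 0 (zero_mem _) (by rw [add_zero]; exact hx.2)).1

theorem ExactAtTwo.right (h : P.ExactAtTwo a b n) :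
    P.block b (n - b) 0 ⊓ P.I (n - 1) * tpow k V 1 ≤
      tpow k V (n - b - 1) * P.Jbar b (b + 1) ⊔ P.I (n - b) * P.R b :=
  fun y hy => (h 0 (zero_mem _) y hy.1 (by rw [zero_add]; exact hy.2)).2

/-- In degree `2a - 1` the error term `I_{a-1} ⊗ R_a` of exactness is zero. -/
theorem extraCondition_left (h : ∀ n : ℕ, P.ExactAtTwo a b n) (ha : 2 ≤ a) (hab : a < b) :
    P.ExtraCondition a := by
  rw [extraCondition_iff ha]
  have h1 := (h (2 * a - 1)).left
  rw [show ((2 * a - 1 : ℕ) : ℤ) = 2 * a - 1 by omega, show (2 * a - 1 - a : ℤ) = a - 1 by ring,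
    I_eq_bot (a := a) (n := a - 1) (by simp; omega) (by omega), Submodule.bot_mul, sup_bot_eq,
    show (a - 1 - 1 : ℤ) = a - 2 by ring] at h1
  exact (inf_le_inf_left _ (sumR_le_I_mul_tpow mem_pair_left (by omega) (by omega)
    (by omega))).trans h1

/-- For `c = b - 1` this is the extra condition for `b`, but exactness leaves an error `z` in `I_c ⊗
R_b`, possibly nonzero for `c ≥ a`. Rewriting `z` by exactness in lower degrees shows that it only
involves copies of `R_b` starting at positions `≥ a`. The first `a` letters can then be split off,
and the strong induction applies to `c - a`. -/
theorem block_inf_sumR_le_of_exactAtTwo (h : ∀ n : ℕ, P.ExactAtTwo a b n) (ha : 2 ≤ a)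
    (hab : a < b) (c : ℕ) (hc : c + 1 ≤ b) :
    P.block b c 0 ⊓ P.sumR b (c + b) 0 (c - 1) ≤ tpow k V (c - 1) * P.Jbar b (b + 1) := by
  induction c using Nat.strong_induction_on with
  | _ c ih =>
    have hbJ : tpow k V (c - 1) * P.Jbar b (b + 1) ≤
        P.block b c 0 ⊓ P.sumR b (c + b) 0 (c - 1) :=
      (tpow_mul_Jbar_succ_le (by omega)).trans (inf_le_inf_left _
        (sumR_le fun j _ _ _ _ => block_le_sumR (by omega) (by omega) (by omega)))
    have h1 := (h (c + b)).right
    push_cast at h1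
    rw [add_sub_cancel_right] at h1
    rintro y ⟨hy, hyS⟩
    obtain ⟨y', hy', z, hz, rfl⟩ := Submodule.mem_sup.1 (h1 ⟨hy, sumR_le_I_mul_tpow mem_pair_right
      (by omega) (by omega) (by omega) hyS⟩)
    refine add_mem hy' ?_
    have hzb : z ∈ P.block b c 0 := I_mul_R_le hz
    have hzS : z ∈ P.sumR b (c + b) 0 (c - 1) := by
      simpa using sub_mem hyS (hbJ hy').2
    have hzI : z ∈ P.I c * tpow k V b := mul_le_mul_right (P.le_tpow b mem_pair_right) _ hz
    -- `W` collects the error terms of the rewriting. Each has a relation in front of its copy of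
    -- `R_b`, so this copy starts at a position `≥ a` (`hW`).
    let W := ∑ i ∈ Finset.Icc (0 : ℤ) (c - 1), P.I i * P.R b * tpow k V (c - i)
    have hW : W ≤ P.sumR b (c + b) a (c - 1) := by
      refine Presentation.sum_le _ _ _ fun i hi => ?_
      rw [Finset.mem_Icc] at hi
      obtain hia | hia := lt_or_ge i a
      · rw [I_eq_bot (a := a) (by simp; omega) hia, Submodule.bot_mul, Submodule.bot_mul]
        exact bot_le
      · exact (mul_le_mul_left I_mul_R_le _).trans ((block_mul_tpow_le (zero_add _)).trans
          (block_le_sumR (by omega) hia hi.2))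
    have hWI {t : ℤ} (h0 : 0 ≤ t) (h1 : t < c) :
        W ≤ P.I (t + b - 1) * tpow k V (c - t + 1) := by
      refine Presentation.sum_le _ _ _ fun i hi => ?_
      rw [Finset.mem_Icc] at hi
      refine (mul_le_mul_left (mul_le_mul_right (P.le_tpow b mem_pair_right) _) _).trans ?_
      rw [mul_assoc, tpow_mul_tpow (by omega) (by omega) rfl]
      exact I_mul_tpow_le_I_mul_tpow (by omega) (by omega) (by omega)
    -- After `j` rounds the rightmost `j` positions of `R_b` have been cleared, modulo `W`.
    have key : ∀ j : ℕ, j ≤ c → z ∈ P.sumR b (c + b) 0 (c - 1 - j) ⊔ W := by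
      intro j
      induction j with
      | zero => exact fun _ => Submodule.mem_sup_left (by simpa using hzS)
      | succ j ihj =>
        intro hj
        obtain ⟨t, ht⟩ : ∃ t : ℕ, t + 1 + j = c := ⟨c - 1 - j, by omega⟩
        rw [show (c : ℤ) - 1 - (j + 1 : ℕ) = t - 1 by omega]
        obtain ⟨p, hp, w, hw, hpw⟩ := Submodule.mem_sup.1 (ihj (by omega))
        have hpt : p ∈ P.sumR b (c + b) 0 (t - 1) ⊔ P.block b t (c - t) := by
          refine sumR_le (fun i h1 h2 _ _ => ?_) hp
          obtain h3 | h3 := le_or_gt i (t - 1)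
          · exact (block_le_sumR (by omega) h1 h3).trans le_sup_left
          · obtain rfl : i = t := by omega
            exact le_sup_of_le_right (le_of_eq (by congr 1; omega))
        obtain ⟨p', hp', r, hr, rfl⟩ := Submodule.mem_sup.1 hpt
        -- The rightmost term `r`, at position `t`, is a cycle with its last `c - t` letters as
        -- spectators: all other terms, and `z` itself, have relations within the first `t + b - 1`
        -- letters. Here `c ≤ b - 1` is used.
        have hrI : r ∈ P.I (t + b - 1) * tpow k V (c - t + 1) := by
          rw [show r = z - p' - w by rw [← hpw]; abel]
          refine sub_mem (sub_mem ?_ ?_) (hWI (by omega) (by omega) hw)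
          · exact I_mul_tpow_le_I_mul_tpow (by omega) (by omega) (by omega) hzI
          · exact sumR_le_I_mul_tpow mem_pair_right (by omega) (by omega) (by omega) hp'
        have h2 := (h (t + b)).right
        push_cast at h2
        rw [add_sub_cancel_right] at h2
        -- Exactness in degree `t + b` replaces `r` by a term at position `t - 1`, coming from
        -- `J̄^b_{b+1}`, and an error term in `W`.
        have hrb : P.block b t (c - t) ⊓ P.I (t + b - 1) * tpow k V (c - t + 1) ≤
            P.sumR b (c + b) 0 (t - 1) ⊔ W := by
          rw [← block_mul_tpow (j := 0) (c := c - t) (l := c - t) le_rfl (by omega) (by omega),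
            ← tpow_mul_tpow (m := 1) (n := c - t) (l := c - t + 1) (by omega) (by omega) (by omega),
            ← mul_assoc (P.I _),
            ← inf_mul_tpow]
          refine (mul_le_mul_left h2 _).trans ?_
          rw [Submodule.sup_mul]
          refine sup_le_sup ?_ (le_sum (X := fun i : ℤ => P.I i * P.R b * tpow k V (c - i))
            (Finset.mem_Icc.2 ⟨by omega, by omega⟩))
          obtain rfl | ht0 := t.eq_zero_or_pos
          · simp [tpow_neg]
          · exact (mul_le_mul_left (tpow_mul_Jbar_le_block (r := t - 1) (j := 1) (by omega)
              le_rfl (by omega) (by omega)) _).trans ((block_mul_tpow_le rfl).trans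
                (block_le_sumR (by omega) (by omega) le_rfl))
        rw [← hpw]
        exact add_mem (add_mem (Submodule.mem_sup_left hp') (hrb ⟨hr, hrI⟩))
          (Submodule.mem_sup_right hw)
    have hza : z ∈ P.sumR b (c + b) a (c - 1) := by
      have h2 := key c le_rfl
      rw [sumR_eq_bot (by omega), bot_sup_eq] at h2
      exact hW h2
    -- For `c ≤ a` no position between `a` and `c - 1` is left, so `z = 0`.
    obtain hca | hca := lt_or_ge (c : ℤ) (a + 1)
    · rw [sumR_eq_bot (by omega), Submodule.mem_bot] at hza
      rw [hza]
      exact zero_mem _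
    · obtain ⟨d, rfl⟩ : ∃ d, c = a + d := ⟨c - a, by omega⟩
      have h2 : P.block b (a + d : ℕ) 0 ⊓ P.sumR b ((a + d : ℕ) + b) a ((a + d : ℕ) - 1) ≤
          tpow k V a * (P.block b d 0 ⊓ P.sumR b (d + b) 0 (d - 1)) := by
        rw [tpow_mul_inf, tpow_mul_block (l := (a + d : ℕ)) (by omega) (by omega) (by omega)]
        exact inf_le_inf_left _
          (sumR_le_tpow_mul (by omega) (by omega) le_rfl (by omega) (by omega))
      rw [← tpow_mul_tpow (m := a) (n := d - 1) (l := (a + d : ℕ) - 1) (by omega) (by omega)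
        (by omega), mul_assoc]
      exact mul_le_mul_right (ih d (by omega) (by omega)) _ (h2 ⟨hzb, hza⟩)

theorem extraCondition_right (h : ∀ n : ℕ, P.ExactAtTwo a b n) (ha : 2 ≤ a) (hab : a < b) :
    P.ExtraCondition b := by
  rw [extraCondition_iff (by omega)]
  have h1 := block_inf_sumR_le_of_exactAtTwo h ha hab (b - 1) (by omega)
  rw [show ((b - 1 : ℕ) : ℤ) = b - 1 by omega, show (b - 1 + b : ℤ) = 2 * b - 1 by ring,
    show (b - 1 - 1 : ℤ) = b - 2 by ring] at h1
  exact h1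

/-! ### The lattice conditions imply exactness -/

/-- Minimality is the case `c = 0`. For larger `c`, bidistributivity and the extra condition for `b`
show that neither the copy of `R_b` nor the relations `R_a` need the last letter, which can then be
split off. -/
theorem block_inf_sumR_eq_bot (ha : 2 ≤ a) (hab : a < b) (heb : P.ExtraCondition b)
    (h : ∀ n : ℕ, a < n → P.BidistributiveAt a b n) (c : ℕ) (hc : c + 1 ≤ a) :
    P.block b c 0 ⊓ P.sumR a (c + b) 0 (c + b - a) = ⊥ := by
  rw [eq_bot_iff]
  induction c with
  | zero =>
    refine le_trans (le_of_eq ?_) (R_inf_sumR (P := P) hab).le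
    rw [R_eq_block]
    simp
  | succ c ih =>
    have hb := (bidistributiveAt_iff ha hab).1 (h (c + 1 + b) (by omega))
    rintro x ⟨hx, hxS⟩
    -- Write `x = f + e`, where only `e` has its relation `R_a` at the very end. Then `f = x - e`
    -- lies in `E'' + E'` and leaves the last letter free, so bidistributivity applies to `f`.
    have hxS' : x ∈ P.sumR a (c + 1 + b : ℕ) 0 ((c + 1 + b : ℕ) - a - 1) ⊔
        P.block a ((c + 1 + b : ℕ) - a) 0 := by
      refine sumR_le (fun i h1 h2 _ _ => ?_) hxS
      obtain h3 | h3 := le_or_gt i ((c + 1 + b : ℕ) - a - 1)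
      · exact (block_le_sumR (by omega) h1 h3).trans le_sup_left
      · exact le_sup_of_le_right (le_of_eq (by congr 1 <;> omega))
    obtain ⟨f, hf, e, he, rfl⟩ := Submodule.mem_sup.1 hxS'
    have hx' : f + e ∈ P.block b ((c + 1 + b : ℕ) - b) 0 := by
      rwa [show ((c + 1 + b : ℕ) - b : ℤ) = (c + 1 : ℕ) by omega]
    obtain ⟨p, hp, r, hr, hpr⟩ := Submodule.mem_sup.1 (hb (x := f) ⟨by
      simpa using sub_mem (Submodule.mem_sup_right (S := P.block a ((c + 1 + b : ℕ) - a) 0) hx')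
        (Submodule.mem_sup_left he), sumR_le_I_mul_tpow mem_pair_left (by omega) (by omega)
          (by omega) hf⟩)
    -- Here `n - b = c + 1 < a`, so no relation fits in front of `R_b`, and `r` lies in `E'' ⊓ G''`.
    rw [I_eq_bot (a := a) (n := (c + 1 + b : ℕ) - b) (by simp; omega) (by omega),
      Submodule.bot_mul, bot_sup_eq] at hr
    have hpa := (sup_le I_mul_R_le inf_le_left : _ ≤ (_ : Submodule _ _)) hp
    have hpS : p ∈ P.sumR a (c + 1 + b : ℕ) 0 ((c + 1 + b : ℕ) - a - 1) := by
      refine (sup_le ?_ (inf_le_right.trans ?_) : _ ≤ (_ : Submodule _ _)) hp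
      · refine (mul_le_mul_right (P.le_tpow a mem_pair_left) _).trans ?_
        rw [I, Finset.sum_mul]
        refine Presentation.sum_le _ _ _ fun t ht => ?_
        obtain rfl | rfl : t = a ∨ t = b := by simpa using ht
        · exact sumR_mul_tpow_le (by omega) le_rfl (by omega)
        -- In front of `R_a` there are fewer than `b` letters, so no `R_b` fits there.
        · change P.sumR t ((c + 1 + t : ℕ) - a) 0 ((c + 1 + t : ℕ) - a - t) * _ ≤ _
          rw [sumR_eq_bot (by omega), Submodule.bot_mul]
          exact bot_le
      · exact sumR_mono (by omega) (by omega) (by omega)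
    have h0 : f + e - r ∈ P.block a ((c + 1 + b : ℕ) - a) 0 ⊓
        P.block b ((c + 1 + b : ℕ) - b) 0 := by
      refine ⟨?_, sub_mem hx' hr.1⟩
      rw [← hpr, show p + r + e - r = p + e by abel]
      exact add_mem hpa he
    rw [block_inf_block_eq_bot hab (by omega), Submodule.mem_bot, sub_eq_zero] at h0
    have hfe : f + e ∈ P.sumR a (c + 1 + b : ℕ) 0 ((c + 1 + b : ℕ) - a - 1) := by
      rw [h0, ← sub_eq_of_eq_add' hpr.symm]
      exact sub_mem hf hpS
    refine (mul_le_mul_left (ih (by omega)) (tpow k V 1)).trans_eq (Submodule.bot_mul _) ?_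
    rw [inf_mul_tpow]
    refine ⟨?_, ?_⟩
    · rw [block_mul_tpow (l := 1) le_rfl (by omega) (by omega), h0]
      exact ((heb.block_inf_sumR_le mem_pair_right (by omega) (by omega) (by omega)).trans
        (tpow_mul_Jbar_le_block (by omega) (by omega) (by omega) (by omega))) hr
    · exact sumR_le_mul_tpow (by omega) (by omega) le_rfl (by omega) (by omega) hfe

/-- Relations `R_a` starting at most `a - 1` letters before `R_b` ignore the first `m - a + 1`
letters. Splitting these off leaves the case `c = a - 1`. -/
theorem block_inf_sumR_window_eq_bot (ha : 2 ≤ a) (hab : a < b) (heb : P.ExtraCondition b)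
    (h : ∀ n : ℕ, a < n → P.BidistributiveAt a b n) (m : ℤ) :
    P.block b m 0 ⊓ P.sumR a (m + b) (m - a + 1) (m + b - a) = ⊥ := by
  rw [eq_bot_iff]
  obtain hm | hm := lt_or_ge m 0
  · rw [block_of_left_neg hm, bot_inf_eq]
  obtain hma | hma := lt_or_ge m a
  · lift m to ℕ using hm
    rw [← block_inf_sumR_eq_bot ha hab heb h m (by omega)]
    exact inf_le_inf_left _ (sumR_le fun j _ _ _ _ => block_le_sumR (by omega) (by omega)
      (by omega))
  · have h1 := block_inf_sumR_eq_bot ha hab heb h (a - 1) (by omega)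
    rw [← tpow_mul_block (c := m - a + 1) (i := (a - 1 : ℕ)) (by omega) (by omega) (by omega)]
    refine (inf_le_inf_left _ (sumR_le_tpow_mul (c := m - a + 1) (m' := (a - 1 : ℕ) + b) (l' := 0)
      (u' := (a - 1 : ℕ) + b - a) (by omega) (by omega) (by omega) (by omega) (by omega))).trans ?_
    rw [← tpow_mul_inf, h1, Submodule.mul_bot]

/-- Every `R_a` in the window of `G^b_a` ends no later than the first copy of `R_b` in `J̄^b`. This
is why no inclusion condition is needed for `s = b`. -/
theorem E_inf_G_eq_bot (ha : 2 ≤ a) (hab : a < b) (heb : P.ExtraCondition b)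
    (h : ∀ n : ℕ, a < n → P.BidistributiveAt a b n) (hi : 1 ≤ i) :
    P.E b (i + 1) n ⊓ P.G b a (i + 1) n = ⊥ := by
  have h1 := le_nDeg b (show 2 ≤ i + 1 by omega)
  have h2 : nDeg b (i + 1) + 1 ≤ nDeg b i + b := by
    obtain hi | hi := i.even_or_odd
    · have := nDeg_succ_of_even b hi; omega
    · have := nDeg_succ_of_odd b hi; omega
  rw [eq_bot_iff, E, G, Nat.add_sub_cancel]
  have hE : tpow k V (n - nDeg b (i + 1)) * P.Jbar b (nDeg b (i + 1)) ≤
      P.block b (n - nDeg b (i + 1)) 0 * tpow k V (nDeg b (i + 1) - b) := by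
    rw [block_mul_tpow le_rfl (by omega) rfl]
    exact tpow_mul_Jbar_le_block (by omega) (by omega) (by omega) (by omega)
  refine (inf_le_inf hE (sumR_le_mul_tpow (c := nDeg b (i + 1) - b) (m' := n - nDeg b (i + 1) + b)
    (l' := n - nDeg b (i + 1) - a + 1) (u' := n - nDeg b (i + 1) + b - a) (by omega) (by omega)
    le_rfl (by omega) (by omega))).trans ?_
  rw [← inf_mul_tpow, block_inf_sumR_window_eq_bot ha hab heb h, Submodule.bot_mul]

end Presentation

theorem tpow_mul_tpow_le {k V : Type*} [Field k] [AddCommGroup V] [Module k V] {m n l : ℤ}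
    (h : m + n = l) : tpow k V m * tpow k V n ≤ tpow k V l := by
  by_cases hm : m < 0
  · simp [tpow_neg hm]
  by_cases hn : n < 0
  · simp [tpow_neg hn]
  exact (tpow_mul_tpow (not_lt.1 hm) (not_lt.1 hn) h).le

namespace Presentation

variable {k V : Type*} [Field k] [AddCommGroup V] [Module k V]
  {a b : ℕ} {P : Presentation k V {a, b}} {s i : ℕ} {m n : ℤ}

/-- At `n₀` the window of `G^a_b` starts at position `0`. In higher degrees both `E` and `G` only
acquire a left factor `V^{(n - n₀)}`, so one degree suffices. -/
theorem E_inf_G_le_of_le {n₀ : ℤ} (hb : 1 ≤ b) (hn₀ : n₀ = nDeg a (i + 1) + b - 1) (hn : n₀ ≤ n)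
    (h : P.E a (i + 1) n₀ ⊓ P.G a b (i + 1) n₀ ≤
      tpow k V (n₀ - nDeg a (i + 2)) * P.Jbar a (nDeg a (i + 2)) ⊔
        P.I (n₀ - nDeg a (i + 1)) * P.Jbar a (nDeg a (i + 1))) :
    P.E a (i + 1) n ⊓ P.G a b (i + 1) n ≤
      tpow k V (n - nDeg a (i + 2)) * P.Jbar a (nDeg a (i + 2)) ⊔
        P.I (n - nDeg a (i + 1)) * P.Jbar a (nDeg a (i + 1)) := by
  have hE : P.E a (i + 1) n ≤ tpow k V (n - n₀) * P.E a (i + 1) n₀ := by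
    rw [E, E, ← mul_assoc, tpow_mul_tpow (l := n - nDeg a (i + 1)) (by omega) (by omega) (by omega)]
  have hG : P.G a b (i + 1) n ≤ tpow k V (n - n₀) * P.G a b (i + 1) n₀ :=
    sumR_le_tpow_mul (by omega) (by omega) (by omega) (by omega) (by omega)
  refine (inf_le_inf hE hG).trans ?_
  rw [← tpow_mul_inf]
  refine (mul_le_mul_right h _).trans ?_
  rw [Submodule.mul_sup, ← mul_assoc, ← mul_assoc]
  exact sup_le_sup (mul_le_mul_left (tpow_mul_tpow_le (by omega)) _)
    (mul_le_mul_left (tpow_mul_I_le (by omega)) _)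

/-- Below degree `n_a(i) + b` the window is empty, and above `n_a(i+1) + b - 1` `E_inf_G_le_of_le`
applies. In between, replacing `J̄^a` by its first copy of `R_a` puts `E ⊓ G` into `X ⊗
V^{(n_a(i-1))}`. -/
theorem E_inf_G_le_of_evenInclusion (hb : 1 ≤ b) (hi : Odd i) (hi2 : 2 ≤ i)
    (h : ∀ n : ℕ, nDeg a i + b ≤ n → n ≤ nDeg a (i + 1) + b - 1 → P.EvenInclusion a b (i + 1) n)
    (n : ℕ) :
    P.E a (i + 1) n ⊓ P.G a b (i + 1) n ≤
      tpow k V (n - nDeg a (i + 2)) * P.Jbar a (nDeg a (i + 2)) ⊔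
        P.I (n - nDeg a (i + 1)) * P.Jbar a (nDeg a (i + 1)) := by
  have h1 := nDeg_succ_of_odd a hi
  have h2 := le_nDeg a (show 2 ≤ i + 1 by omega)
  have key (n : ℕ) (hn : n ≤ nDeg a (i + 1) + b - 1) :
      P.E a (i + 1) n ⊓ P.G a b (i + 1) n ≤
        tpow k V (n - nDeg a (i + 2)) * P.Jbar a (nDeg a (i + 2)) ⊔
          P.I (n - nDeg a (i + 1)) * P.Jbar a (nDeg a (i + 1)) := by
    obtain hn' | hn' := lt_or_ge n (nDeg a i + b)
    · rw [G, Nat.add_sub_cancel, sumR_eq_bot (by omega), inf_bot_eq]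
      exact bot_le
    refine le_trans (le_inf inf_le_left ?_) (h n hn' hn)
    obtain ⟨i, rfl⟩ : ∃ j, i = j + 1 := ⟨i - 1, by omega⟩
    have h3 : nDeg a (i + 1 + 1) = nDeg a i + a := nDeg_add_two a i
    rw [X, tpow_mul_R, inf_mul_tpow, show i + 1 + 1 - 2 = i by omega, G, E, Nat.add_sub_cancel,
      block_mul_tpow le_rfl (by omega) (zero_add _)]
    refine inf_le_inf (tpow_mul_Jbar_le_block (by omega) le_rfl (by omega) (by omega)) ?_
    exact (sumR_mono (l' := 0) id (fun _ => le_rfl) le_rfl).trans (sumR_le_mul_tpow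
      (c := nDeg a i) (by omega) (by omega) le_rfl (by omega) (by omega))
  obtain hn | hn := le_or_gt n (nDeg a (i + 1) + b - 1)
  · exact key n hn
  · exact E_inf_G_le_of_le (n₀ := (nDeg a (i + 1) + b - 1 : ℕ)) hb (by omega) (by omega)
      (key _ le_rfl)

/-- For `i` even the window of `G^a_b` has a single position, which becomes nonnegative in degree
`n_a(i+1) + b - 1`. There it is position `0`, the situation of `OddInclusion`. -/
theorem E_inf_G_le_of_oddInclusion (ha : 2 ≤ a) (hb : 1 ≤ b) (hi : Even i) (hi2 : 2 ≤ i)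
    (h : P.OddInclusion a b (i + 1)) (n : ℕ) :
    P.E a (i + 1) n ⊓ P.G a b (i + 1) n ≤
      tpow k V (n - nDeg a (i + 2)) * P.Jbar a (nDeg a (i + 2)) ⊔
        P.I (n - nDeg a (i + 1)) * P.Jbar a (nDeg a (i + 1)) := by
  have h1 := nDeg_succ_of_even a hi
  have h2 := le_nDeg a (show 2 ≤ i + 1 by omega)
  obtain hn | hn := lt_or_ge (n : ℤ) (nDeg a (i + 1) + b - 1)
  · rw [G, Nat.add_sub_cancel, sumR_eq_bot (by omega), inf_bot_eq]
    exact bot_le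
  refine E_inf_G_le_of_le hb rfl hn ?_
  obtain ⟨i, rfl⟩ : ∃ j, i = j + 1 := ⟨i - 1, by omega⟩
  have h3 : nDeg a (i + 1 + 1) = nDeg a i + a := nDeg_add_two a i
  have h4 := nDeg_add_two a (i + 1)
  rw [OddInclusion, show i + 1 + 1 - 2 = i by omega, Submodule.add_eq_sup] at h
  rw [E, G, Nat.add_sub_cancel,
    show ((nDeg a (i + 1 + 1) : ℕ) : ℤ) + b - 1 - (nDeg a (i + 1 + 1) : ℕ) = b - 1 by omega,
    show ((nDeg a (i + 1 + 1) : ℕ) : ℤ) + b - 1 - (nDeg a (i + 1 + 2) : ℕ) = b - a by omega]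
  refine le_trans (le_inf inf_le_left ?_) h
  rw [tpow_mul_R, R_mul_tpow, inf_mul_tpow, block_mul_tpow le_rfl (by omega) (zero_add _),
    block_mul_tpow (by omega) (by omega) rfl]
  refine inf_le_inf (tpow_mul_Jbar_le_block (by omega) le_rfl (by omega) (by omega)) ?_
  refine sumR_le fun j h5 h6 _ _ => ?_
  obtain rfl : j = 0 := by omega
  exact le_of_eq (by congr 1; omega)

theorem exactAt_of_distributiveAt (hs : 2 ≤ s) (hsS : s ∈ ({a, b} : Finset ℕ))
    (h : P.DistributiveAt a b s (i + 1) n)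
    (ha : P.E s (i + 1) n ⊓ P.G s a (i + 1) n ≤
      tpow k V (n - nDeg s (i + 2)) * P.Jbar s (nDeg s (i + 2)) ⊔
        P.I (n - nDeg s (i + 1)) * P.Jbar s (nDeg s (i + 1)))
    (hb : P.E s (i + 1) n ⊓ P.G s b (i + 1) n ≤
      tpow k V (n - nDeg s (i + 2)) * P.Jbar s (nDeg s (i + 2)) ⊔
        P.I (n - nDeg s (i + 1)) * P.Jbar s (nDeg s (i + 1))) : P.ExactAt s i n := by
  rw [distributiveAt_iff hs] at h
  exact h.trans (sup_le (sup_le ((E_inf_F_le hsS).trans le_sup_right) ha) hb)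

theorem distributiveAt_of_lt (hs : 2 ≤ s) (hn : n < nDeg s (i + 1)) :
    P.DistributiveAt a b s (i + 1) n := by
  rw [distributiveAt_iff hs, E, tpow_neg (by omega), Submodule.bot_mul, bot_inf_eq]
  exact bot_le

theorem bidistributiveAt_of_le (ha : 2 ≤ a) (hab : a < b) (hn : n ≤ a) :
    P.BidistributiveAt a b n := by
  rw [bidistributiveAt_iff ha hab, I_eq_bot (a := a) (by simp; omega) (by omega),
    Submodule.bot_mul, inf_bot_eq]
  exact bot_le

variable (P) in
/-- The lattice conditions, in the ranges of degrees in which they are not automatic, are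
equivalent to the exactness of the multi-Koszul complex in all degrees. -/
theorem lattice_conditions_iff (ha : 2 ≤ a) (hab : a < b) :
    ((P.ExtraCondition a ∧ P.ExtraCondition b) ∧
        (∀ i : ℕ, 3 ≤ i → Even i → ∀ n : ℕ, nDeg a (i - 1) + b ≤ n → n ≤ nDeg a i + b - 1 →
          P.EvenInclusion a b i n) ∧
        (∀ i : ℕ, 3 ≤ i → Odd i → P.OddInclusion a b i) ∧
        (∀ n : ℕ, a < n → P.BidistributiveAt a b n) ∧
        (∀ i : ℕ, 3 ≤ i → ∀ s ∈ ({a, b} : Finset ℕ), ∀ n : ℕ, nDeg s i ≤ n →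
          P.DistributiveAt a b s i n)) ↔
      (∀ n : ℕ, P.ExactAtTwo a b n) ∧
        ∀ i : ℕ, 2 ≤ i → ∀ s ∈ ({a, b} : Finset ℕ), ∀ n : ℕ, P.ExactAt s i n := by
  constructor
  · rintro ⟨⟨hea, heb⟩, heven, hodd, hbi, hdi⟩
    have hbi' (n : ℕ) : P.BidistributiveAt a b n := by
      obtain hn | hn := le_or_gt n a
      · exact bidistributiveAt_of_le ha hab (by omega)
      · exact hbi n hn
    refine ⟨fun n => exactAtTwo_of_bidistributiveAt (hbi' n) ha hab hea heb, ?_⟩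
    intro i hi s hs n
    have hs2 := P.two_le s hs
    have hd : P.DistributiveAt a b s (i + 1) n := by
      obtain hn | hn := lt_or_ge n (nDeg s (i + 1))
      · exact distributiveAt_of_lt hs2 (by omega)
      · exact hdi _ (by omega) s hs n hn
    obtain rfl | rfl : s = a ∨ s = b := by simpa using hs
    · refine exactAt_of_distributiveAt hs2 hs hd ?_ ?_
      · exact (hea.E_inf_G_le hs (by omega)).trans le_sup_left
      · obtain hi' | hi' := i.even_or_odd
        · exact E_inf_G_le_of_oddInclusion ha (by omega) hi' hi
            (hodd _ (by omega) hi'.add_one) n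
        · exact E_inf_G_le_of_evenInclusion (by omega) hi' hi
            (heven _ (by omega) hi'.add_one) n
    · refine exactAt_of_distributiveAt hs2 hs hd ?_ ?_
      · rw [E_inf_G_eq_bot ha hab heb hbi (by omega)]
        exact bot_le
      · exact (heb.E_inf_G_le hs (by omega)).trans le_sup_left
  · rintro ⟨h2, h⟩
    refine ⟨⟨extraCondition_left h2 ha hab, extraCondition_right h2 ha hab⟩, ?_, ?_, ?_, ?_⟩
    · intro i hi hi' n _ _
      obtain ⟨i, rfl⟩ : ∃ j, i = j + 1 := ⟨i - 1, by omega⟩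
      refine (h i (by omega) a mem_pair_left n).evenInclusion ?_
      rwa [Nat.even_add_one, Nat.not_even_iff_odd] at hi'
    · intro i hi hi'
      obtain ⟨i, rfl⟩ : ∃ j, i = j + 1 := ⟨i - 1, by omega⟩
      have h1 := h i (by omega) a mem_pair_left (nDeg a (i + 1) + b - 1)
      rw [show ((nDeg a (i + 1) + b - 1 : ℕ) : ℤ) = nDeg a (i + 1) + b - 1 by omega] at h1
      refine h1.oddInclusion ?_ (by omega) ha
      rwa [Nat.odd_add_one, Nat.not_odd_iff_even] at hi'
    · exact fun n _ => (h2 n).bidistributiveAt ha hab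
    · intro i hi s hs n _
      obtain ⟨i, rfl⟩ : ∃ j, i = j + 1 := ⟨i - 1, by omega⟩
      exact (h i (by omega) s hs n).distributiveAt hs (by omega)

end Presentation

/-! ### Representing elements of `A ⊗ T(V)` by elements of `T(V)` -/

namespace Presentation

variable {k V : Type*} [Field k] [AddCommGroup V] [Module k V] {S : Finset ℕ}
  (P : Presentation k V S)

/-- The ideal `⟨R⟩` as a subspace of `T(V)`. -/
def relSubmodule : Submodule k (TensorAlgebra k V) := P.relIdeal.restrictScalars k

/-- The linear map `T(V) → A ⊗ T(V)` splitting off the last `q` letters. -/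
def splitLast (q : ℕ) : TensorAlgebra k V →ₗ[k] P.Alg ⊗[k] TensorAlgebra k V :=
  factorRight q ((TensorProduct.mk k P.Alg (TensorAlgebra k V)).comp P.proj.toLinearMap)

/-- The homogeneous components of elements of `T(V)`. -/
def component (k V : Type*) [Field k] [AddCommGroup V] [Module k V] (n : ℕ) :
    TensorAlgebra k V →ₗ[k] TensorAlgebra k V :=
  GradedAlgebra.proj (fun n : ℕ => LinearMap.range (TensorAlgebra.ι k (M := V)) ^ n) n

variable {P} {s c i q n : ℕ} {x u w : TensorAlgebra k V} {Y : Submodule k (TensorAlgebra k V)}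

/-! ### The ideal of relations -/

theorem mem_relSubmodule : x ∈ P.relSubmodule ↔ P.proj x = 0 :=
  (Ideal.Quotient.eq_zero_iff_mem (I := P.relIdeal)).symm

theorem mul_mem_relSubmodule_left (hx : x ∈ P.relSubmodule) : u * x ∈ P.relSubmodule := by
  rw [mem_relSubmodule] at *
  rw [map_mul, hx, mul_zero]

theorem mul_mem_relSubmodule_right (hx : x ∈ P.relSubmodule) : x * u ∈ P.relSubmodule := by
  rw [mem_relSubmodule] at *
  rw [map_mul, hx, zero_mul]

theorem mul_relSubmodule_le : Y * P.relSubmodule ≤ P.relSubmodule :=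
  Submodule.mul_le.2 fun _ _ _ hx => mul_mem_relSubmodule_left hx

theorem relSubmodule_mul_le : P.relSubmodule * Y ≤ P.relSubmodule :=
  Submodule.mul_le.2 fun _ hx _ _ => mul_mem_relSubmodule_right hx

theorem R_le_relSubmodule (hs : s ∈ S) : P.R s ≤ P.relSubmodule := fun _ hx =>
  TwoSidedIdeal.mem_asIdeal.2 (TwoSidedIdeal.subset_span (Set.mem_iUnion₂.2 ⟨s, hs, hx⟩))

theorem block_le_relSubmodule (hs : s ∈ S) {i j : ℤ} : P.block s i j ≤ P.relSubmodule :=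
  (mul_le_mul_left ((mul_le_mul_right (R_le_relSubmodule hs) _).trans mul_relSubmodule_le) _).trans
    relSubmodule_mul_le

theorem I_le_relSubmodule {n : ℤ} : P.I n ≤ P.relSubmodule :=
  I_le fun _ hs => sumR_le fun _ _ _ _ _ => block_le_relSubmodule hs

/-- In `hr` the element is also known to lie in the ideal; `relSubmodule_le_sup` relies on this. -/
theorem relSubmodule_le (h : ∀ s ∈ S, P.R s ≤ Y)
    (hl : ∀ u, ∀ x ∈ Y, u * x ∈ Y) (hr : ∀ u, ∀ x ∈ P.relSubmodule, x ∈ Y → x * u ∈ Y) :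
    P.relSubmodule ≤ Y := by
  intro x hx
  refine TwoSidedIdeal.span_induction (p := fun x _ => x ∈ Y) ?_ (zero_mem _)
    (fun _ _ _ _ => add_mem) (fun _ _ => neg_mem) (fun u x _ hx => hl u x hx)
    (fun u x hx' hx => hr u x (TwoSidedIdeal.mem_asIdeal.2 hx') hx) (TwoSidedIdeal.mem_asIdeal.1 hx)
  intro x hx
  obtain ⟨s, hs, hx⟩ := Set.mem_iUnion₂.1 hx
  exact h s hs hx

theorem sub_algebraMapInv_mem (x : TensorAlgebra k V) :
    x - algebraMap k _ (TensorAlgebra.algebraMapInv x) ∈ ⊤ * tpow k V 1 := by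
  induction x using TensorAlgebra.induction with
  | algebraMap r => simp
  | ι v =>
    have h : TensorAlgebra.ι k v ∈ ⊤ * tpow k V 1 := by
      rw [tpow_one, ← one_mul (TensorAlgebra.ι k v)]
      exact Submodule.mul_mem_mul trivial (LinearMap.mem_range_self _ v)
    simpa [TensorAlgebra.algebraMapInv] using h
  | mul x y hx hy =>
    rw [map_mul, map_mul, show ∀ p q : TensorAlgebra k V, x * y - p * q = x * (y - q) + (x - p) * q
      from fun p q => by noncomm_ring, ← Algebra.commutes, ← Algebra.smul_def]
    refine add_mem ?_ (Submodule.smul_mem _ _ hx)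
    have h := Submodule.mul_mem_mul (Submodule.mem_top (x := x) (R := k)) hy
    rw [← mul_assoc] at h
    exact (mul_le_mul_left le_top _ : _ ≤ (⊤ : Submodule k (TensorAlgebra k V)) * tpow k V 1) h
  | add x y hx hy =>
    rw [map_add, map_add, add_sub_add_comm]
    exact add_mem hx hy

/-! ### Homogeneous components -/

theorem component_of_mem (hx : x ∈ tpow k V n) : component k V n x = x := by
  rw [tpow_natCast] at hx
  exact DirectSum.decompose_of_mem_same _ hx

theorem sum_component (x : TensorAlgebra k V) (h : ∀ n, component k V n x ∈ Y) : x ∈ Y := by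
  classical
  rw [← DirectSum.sum_support_decompose
    (fun n : ℕ => LinearMap.range (TensorAlgebra.ι k (M := V)) ^ n) x]
  exact sum_mem fun n _ => h n

theorem component_mem_tpow (n : ℕ) (x : TensorAlgebra k V) : component k V n x ∈ tpow k V n := by
  rw [tpow_natCast]
  exact SetLike.coe_mem (DirectSum.decompose
    (fun n : ℕ => LinearMap.range (TensorAlgebra.ι k (M := V)) ^ n) x n)

theorem component_mul_right (hw : w ∈ tpow k V q) (u : TensorAlgebra k V) :
    component k V n (u * w) = if q ≤ n then component k V (n - q) u * w else 0 := by
  rw [tpow_natCast] at hw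
  exact DirectSum.coe_decompose_mul_of_right_mem _ n hw

theorem component_mul_left (hw : w ∈ tpow k V q) (u : TensorAlgebra k V) :
    component k V n (w * u) = if q ≤ n then w * component k V (n - q) u else 0 := by
  rw [tpow_natCast] at hw
  exact DirectSum.coe_decompose_mul_of_left_mem _ n hw

theorem component_mem_top_mul (hY : Y ≤ tpow k V q) (hx : x ∈ ⊤ * Y) :
    component k V n x ∈ tpow k V (n - q) * Y := by
  refine mul_le_of_map _ (fun u _ w hw => ?_) x hx
  rw [component_mul_right (hY hw)]
  split_ifs with h
  · rw [← Nat.cast_sub h]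
    exact Submodule.mul_mem_mul (component_mem_tpow _ _) hw
  · exact zero_mem _

/-- The elements all of whose components lie in the spaces `I_n` form a two-sided ideal containing
the relations. Closure under multiplication is checked on homogeneous factors. -/
theorem component_mem_I (hx : x ∈ P.relSubmodule) (n : ℕ) : component k V n x ∈ P.I n := by
  let Z : Submodule k (TensorAlgebra k V) := ⨅ n : ℕ, (P.I n).comap (component k V n)
  have hZ {x : TensorAlgebra k V} : x ∈ Z ↔ ∀ n : ℕ, component k V n x ∈ P.I n := by
    simp [Z, Submodule.mem_iInf]
  have hind (f : TensorAlgebra k V →ₗ[k] TensorAlgebra k V)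
      (h : ∀ i : ℕ, ∀ u ∈ tpow k V i, f u ∈ Z) (u : TensorAlgebra k V) : f u ∈ Z :=
    sum_component (Y := Z.comap f) u fun i => h i _ (component_mem_tpow i u)
  suffices h : P.relSubmodule ≤ Z from hZ.1 (h hx) n
  refine relSubmodule_le (fun s hs x hx => hZ.2 fun n => ?_) ?_ ?_
  · have h1 := component_mul_right (n := n) (P.le_tpow s hs hx) 1
    rw [one_mul] at h1
    rw [h1]
    split_ifs with h
    · have h2 := Submodule.mul_mem_mul (component_mem_tpow (k := k) (V := V) (n - s) 1) hx
      rw [tpow_mul_R] at h2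
      exact block_le_I hs (by omega) h2
    · exact zero_mem _
  · intro u x hx
    refine hind (LinearMap.mulRight k x) (fun i u hu => hZ.2 fun n => ?_) u
    rw [LinearMap.mulRight_apply, component_mul_left hu]
    split_ifs with h
    · exact tpow_mul_I_le (by omega) (Submodule.mul_mem_mul hu (hZ.1 hx (n - i)))
    · exact zero_mem _
  · intro u x _ hx
    refine hind (LinearMap.mulLeft k x) (fun i u hu => hZ.2 fun n => ?_) u
    rw [LinearMap.mulLeft_apply, component_mul_right hu]
    split_ifs with h
    · exact I_mul_tpow_le (by omega) (Submodule.mul_mem_mul (hZ.1 hx (n - i)) hu)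
    · exact zero_mem _

theorem component_mem_I_mul (hY : Y ≤ tpow k V q) (hx : x ∈ P.relSubmodule * Y) :
    component k V n x ∈ P.I (n - q) * Y := by
  refine mul_le_of_map _ (fun u hu w hw => ?_) x hx
  rw [component_mul_right (hY hw)]
  split_ifs with h
  · rw [← Nat.cast_sub h]
    exact Submodule.mul_mem_mul (component_mem_I hu _) hw
  · exact zero_mem _

/-! ### Splitting off the last letters -/

theorem splitLast_mul (hw : w ∈ tpow k V q) (u : TensorAlgebra k V) :
    P.splitLast q (u * w) = P.proj u ⊗ₜ w :=
  factorRight_mul _ hw u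

/-- A linear section `σ` of `T(V) → A` turns `splitLast` into an endomorphism that differs from the
identity by elements of `⟨R⟩ V^{(q)}`. -/
theorem splitLast_eq_zero_iff (hx : x ∈ ⊤ * tpow k V q) :
    P.splitLast q x = 0 ↔ x ∈ P.relSubmodule * tpow k V q := by
  constructor
  · intro h
    obtain ⟨σ, hσ⟩ := P.proj.toLinearMap.exists_rightInverse_of_surjective
      (LinearMap.range_eq_top.2 Ideal.Quotient.mk_surjective)
    let f : P.Alg ⊗[k] TensorAlgebra k V →ₗ[k] TensorAlgebra k V :=
      LinearMap.mul' k _ ∘ₗ σ.rTensor _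
    have h1 : ((LinearMap.id : TensorAlgebra k V →ₗ[k] _) - f ∘ₗ P.splitLast q) x ∈
        P.relSubmodule * tpow k V q := by
      refine mul_le_of_map _ (fun u _ w hw => ?_) x hx
      have h2 : u - σ (P.proj u) ∈ P.relSubmodule := by
        rw [mem_relSubmodule, map_sub, sub_eq_zero]
        exact (LinearMap.congr_fun hσ (P.proj u)).symm
      simpa [f, splitLast_mul hw, sub_mul] using Submodule.mul_mem_mul h2 hw
    simpa [h] using h1
  · intro h
    refine (Submodule.mem_bot k).1 (mul_le_of_map _ (fun u hu w hw => ?_) x h)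
    rw [splitLast_mul hw, mem_relSubmodule.1 hu, TensorProduct.zero_tmul]
    exact zero_mem _

theorem mem_baseChange_iff (hY : Y ≤ tpow k V q) {z : P.Alg ⊗[k] TensorAlgebra k V} :
    z ∈ Y.baseChange P.Alg ↔ ∃ x ∈ ⊤ * Y, P.splitLast q x = z := by
  constructor
  · rintro ⟨y, rfl⟩
    induction y using TensorProduct.induction_on with
    | zero => exact ⟨0, zero_mem _, by simp⟩
    | tmul α y =>
      obtain ⟨u, rfl⟩ := Ideal.Quotient.mk_surjective α
      exact ⟨u * y, Submodule.mul_mem_mul trivial y.2, splitLast_mul (hY y.2) u⟩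
    | add y y' hy hy' =>
      obtain ⟨x, hx, hxy⟩ := hy
      obtain ⟨x', hx', hxy'⟩ := hy'
      exact ⟨x + x', add_mem hx hx', by rw [map_add, map_add, hxy, hxy']⟩
  · rintro ⟨x, hx, rfl⟩
    refine mul_le_of_map (U := (Y.baseChange P.Alg).restrictScalars k) _ (fun u _ w hw => ?_) x hx
    rw [splitLast_mul (hY hw)]
    exact Submodule.tmul_mem_baseChange_of_mem _ hw

theorem shift_pow_tmul (hw : w ∈ tpow k V c) (α : P.Alg) (x : TensorAlgebra k V) :
    (P.shift ^ c) (α ⊗ₜ (w * x)) = (α * P.proj w) ⊗ₜ x := by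
  rw [tpow_natCast] at hw
  induction c generalizing α w with
  | zero =>
    rw [pow_zero, Submodule.mem_one] at hw
    obtain ⟨r, rfl⟩ := hw
    simp [Algebra.algebraMap_eq_smul_one, TensorProduct.smul_tmul]
  | succ c ih =>
    rw [pow_succ'] at hw
    refine Submodule.mul_induction_on hw ?_ ?_
    · rintro _ ⟨v, rfl⟩ y hy
      rw [pow_succ, Module.End.mul_apply, mul_assoc, shift_tmul, ih hy, map_mul, mul_assoc]
    · intro y y' hy hy'
      rw [add_mul, TensorProduct.tmul_add, map_add, hy, hy', map_add, mul_add,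
        TensorProduct.add_tmul]

theorem shift_pow_splitLast {q' : ℕ} (h : q' + c = q) (hx : x ∈ ⊤ * tpow k V q) :
    (P.shift ^ c) (P.splitLast q x) = P.splitLast q' x := by
  refine eqOn_mul (F := (P.shift ^ c).restrictScalars k ∘ₗ P.splitLast q) (fun u _ w hw => ?_) x hx
  have h1 : (P.shift ^ c) (P.proj u ⊗ₜ w) = P.splitLast q' (u * w) := by
    rw [← tpow_mul_tpow (m := c) (n := q') (by omega) (by omega) (by omega)] at hw
    refine eqOn_mul (F := (P.shift ^ c).restrictScalars k ∘ₗ TensorProduct.mk k _ _ (P.proj u))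
      (F' := P.splitLast q' ∘ₗ LinearMap.mulLeft k u) (fun y hy y' hy' => ?_) w hw
    simp only [LinearMap.comp_apply, TensorProduct.mk_apply, LinearMap.restrictScalars_apply,
      LinearMap.mulLeft_apply]
    rw [shift_pow_tmul hy, ← mul_assoc, splitLast_mul hy', map_mul]
  simpa [splitLast_mul hw] using h1

theorem top_mul_tpow_le {q' : ℕ} (h : q' ≤ q) :
    (⊤ : Submodule k (TensorAlgebra k V)) * tpow k V q ≤ ⊤ * tpow k V q' := by
  rw [← tpow_mul_tpow (m := (q - q' : ℕ)) (n := q') (l := q) (by omega) (by omega) (by omega),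
    ← mul_assoc]
  exact mul_le_mul_left le_top _

/-- In both parities the differential moves `n_s(i+2) - n_s(i+1)` letters across the tensor sign,
and the word representing the element stays the same. -/
theorem deltaHat_splitLast (hs : s ∈ S) (hx : x ∈ ⊤ * P.Jbar s (nDeg s (i + 2))) :
    P.deltaHat (i + 2) (P.splitLast (nDeg s (i + 2)) x) = P.splitLast (nDeg s (i + 1)) x := by
  have hs2 := P.two_le s hs
  have hJ := P.Jbar_le_tpow hs (nDeg s (i + 2))
  have key (c : ℕ) (hc : nDeg s (i + 1) + c = nDeg s (i + 2))
      (h : ∀ w ∈ P.Jbar s (nDeg s (i + 2)),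
        P.deltaHat (i + 2) (1 ⊗ₜ w) = (P.shift ^ c) (1 ⊗ₜ w)) :
      P.deltaHat (i + 2) (P.splitLast (nDeg s (i + 2)) x) = P.splitLast (nDeg s (i + 1)) x := by
    rw [← shift_pow_splitLast hc (mul_le_mul_right hJ _ hx)]
    refine eqOn_mul (F := (P.deltaHat (i + 2)).restrictScalars k ∘ₗ P.splitLast (nDeg s (i + 2)))
      (F' := (P.shift ^ c).restrictScalars k ∘ₗ P.splitLast (nDeg s (i + 2)))
      (fun u _ w hw => ?_) x hx
    have h1 : P.proj u ⊗ₜ[k] w = P.proj u • ((1 : P.Alg) ⊗ₜ[k] w) := by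
      rw [TensorProduct.smul_tmul', smul_eq_mul, mul_one]
    simp only [LinearMap.comp_apply, LinearMap.restrictScalars_apply]
    rw [splitLast_mul (hJ hw), h1, map_smul, map_smul, h w hw]
  obtain hi | hi := (i + 1).even_or_odd
  · refine key 1 (nDeg_succ_of_even s hi).symm fun w _ => ?_
    rw [deltaHat, if_pos (show Odd (i + 2) from hi.add_one), pow_one]
  · have h1 : nDeg s (i + 2) + 1 = _ := nDeg_succ_of_odd s hi
    refine key (s - 1) (by omega) fun w hw => P.deltaHat_even ?_ hs hw
    exact Nat.not_odd_iff_even.2 hi.add_one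

theorem deltaHat_one_splitLast (hx : x ∈ ⊤ * tpow k V 1) :
    P.deltaHat 1 (P.splitLast 1 x) = P.splitLast 0 x := by
  rw [deltaHat, if_pos odd_one, ← pow_one P.shift]
  exact shift_pow_splitLast rfl hx

theorem disjoint_baseChange_tpow {p q : ℕ} (h : p ≠ q) :
    Disjoint ((tpow k V p).baseChange P.Alg) ((tpow k V q).baseChange P.Alg) := by
  rw [Submodule.disjoint_def]
  intro z hp hq
  obtain ⟨x, hx, rfl⟩ := (mem_baseChange_iff le_rfl).1 hp
  have h1 : (component k V p).baseChange P.Alg (P.splitLast p x) = P.splitLast p x := by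
    refine eqOn_mul (F := ((component k V p).baseChange P.Alg).restrictScalars k ∘ₗ P.splitLast p)
      (fun u _ w hw => ?_) x hx
    simp [splitLast_mul hw, component_of_mem hw]
  obtain ⟨y, hy, hxy⟩ := (mem_baseChange_iff le_rfl).1 hq
  have h2 : (component k V p).baseChange P.Alg (P.splitLast q y) = 0 := by
    refine eqOn_mul (F := ((component k V p).baseChange P.Alg).restrictScalars k ∘ₗ P.splitLast q)
      (F' := 0) (fun u _ w hw => ?_) y hy
    have h3 : component k V p w = 0 := by
      rw [tpow_natCast] at hw
      exact DirectSum.decompose_of_mem_ne _ hw h.symm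
    simp [splitLast_mul hw, h3]
  rw [← h1, ← hxy, h2]

end Presentation

/-! ### Exactness of the complex in terms of representatives -/

namespace Presentation

variable {k V : Type*} [Field k] [AddCommGroup V] [Module k V]

section Exact

variable {S : Finset ℕ} {P : Presentation k V S} {i : ℕ}

theorem exact_delta_iff :
    Function.Exact (P.delta (i + 1)) (P.delta i) ↔
      ∀ z ∈ P.K (i + 1),
        P.deltaHat (i + 1) z = 0 ↔ ∃ w ∈ P.K (i + 2), P.deltaHat (i + 2) w = z := by
  refine ⟨fun h z hz => ?_, fun h z => ?_⟩
  · have h1 := h ⟨z, hz⟩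
    rw [← Subtype.coe_inj, Set.mem_range] at h1
    refine h1.trans ⟨?_, ?_⟩
    · rintro ⟨w, hw⟩
      exact ⟨w, w.2, congrArg Subtype.val hw⟩
    · rintro ⟨w, hw, rfl⟩
      exact ⟨⟨w, hw⟩, rfl⟩
  · rw [← Subtype.coe_inj, Set.mem_range]
    refine (h z z.2).trans ⟨?_, ?_⟩
    · rintro ⟨w, hw, hwz⟩
      exact ⟨⟨w, hw⟩, Subtype.ext hwz⟩
    · rintro ⟨w, rfl⟩
      exact ⟨w, w.2, rfl⟩

theorem delta₀_apply {x : TensorAlgebra k V} (hz : P.splitLast 0 x ∈ P.K 0) :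
    P.delta₀ ⟨P.splitLast 0 x, hz⟩ = TensorAlgebra.algebraMapInv x := by
  have h : x ∈ (⊤ : Submodule k (TensorAlgebra k V)) * tpow k V 0 := by
    rw [tpow_zero, mul_one]
    trivial
  refine eqOn_mul (F := (LinearMap.mul' k k ∘ₗ TensorProduct.map P.augmentation.toLinearMap
    (TensorAlgebra.algebraMapInv (R := k) (M := V)).toLinearMap) ∘ₗ P.splitLast 0)
    (F' := (TensorAlgebra.algebraMapInv (R := k) (M := V)).toLinearMap) (fun u _ w hw => ?_) x h
  rw [LinearMap.comp_apply, splitLast_mul (q := 0) hw]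
  have h1 : P.augmentation (P.proj u) = TensorAlgebra.algebraMapInv u := rfl
  simp only [LinearMap.comp_apply, TensorProduct.map_tmul, AlgHom.toLinearMap_apply,
    LinearMap.mul'_apply, h1, map_mul]

theorem mem_K_zero {z : P.Alg ⊗[k] TensorAlgebra k V} :
    z ∈ P.K 0 ↔ ∃ x, P.splitLast 0 x = z := by
  rw [K, J]
  refine (mem_baseChange_iff (q := 0) le_rfl).trans ?_
  rw [Nat.cast_zero, tpow_zero, mul_one]
  simp

theorem mem_K_one {z : P.Alg ⊗[k] TensorAlgebra k V} :
    z ∈ P.K 1 ↔ ∃ x ∈ ⊤ * tpow k V 1, P.splitLast 1 x = z :=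
  mem_baseChange_iff (q := 1) le_rfl

theorem surjective_delta₀ : Function.Surjective P.delta₀ := by
  intro c
  refine ⟨⟨P.splitLast 0 (algebraMap k _ c), mem_K_zero.2 ⟨_, rfl⟩⟩, ?_⟩
  rw [delta₀_apply]
  simp

theorem algebraMapInv_eq_zero {x : TensorAlgebra k V} (hx : x ∈ ⊤ * tpow k V 1) :
    TensorAlgebra.algebraMapInv x = (0 : k) := by
  refine (Submodule.mem_bot k).1 (mul_le_of_map
    (TensorAlgebra.algebraMapInv (R := k) (M := V)).toLinearMap (fun u _ w hw => ?_) x hx)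
  rw [Submodule.mem_bot, AlgHom.toLinearMap_apply, map_mul,
    algebraMapInv_eq_zero_of_mem_tpow (n := 1) le_rfl hw, mul_zero]

theorem exact_delta_delta₀ : Function.Exact (P.delta 0) P.delta₀ := by
  rintro ⟨z, hz⟩
  obtain ⟨x, rfl⟩ := mem_K_zero.1 hz
  rw [delta₀_apply]
  constructor
  · intro h
    have hx := sub_algebraMapInv_mem x
    rw [h, map_zero, sub_zero] at hx
    exact ⟨⟨P.splitLast 1 x, mem_K_one.2 ⟨x, hx, rfl⟩⟩, Subtype.ext (deltaHat_one_splitLast hx)⟩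
  · rintro ⟨⟨w, hw⟩, h⟩
    obtain ⟨y, hy, rfl⟩ := mem_K_one.1 hw
    have h1 : P.splitLast 0 y = P.splitLast 0 x :=
      (deltaHat_one_splitLast hy).symm.trans (congrArg Subtype.val h)
    have h2 : P.delta₀ ⟨P.splitLast 0 y, mem_K_zero.2 ⟨y, rfl⟩⟩ = P.delta₀ ⟨_, hz⟩ := by
      simp only [h1]
    rw [delta₀_apply, delta₀_apply, algebraMapInv_eq_zero hy] at h2
    exact h2.symm

end Exact

variable {a b : ℕ} {P : Presentation k V {a, b}} {s i : ℕ}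

theorem mem_K_add_two (hab : a ≠ b) {z : P.Alg ⊗[k] TensorAlgebra k V} :
    z ∈ P.K (i + 2) ↔ ∃ x ∈ ⊤ * P.Jbar a (nDeg a (i + 2)), ∃ y ∈ ⊤ * P.Jbar b (nDeg b (i + 2)),
      P.splitLast (nDeg a (i + 2)) x + P.splitLast (nDeg b (i + 2)) y = z := by
  have ha := P.Jbar_le_tpow mem_pair_left (nDeg a (i + 2))
  have hb := P.Jbar_le_tpow mem_pair_right (nDeg b (i + 2))
  constructor
  · intro hz
    rw [K, J, Finset.sum_pair hab, Submodule.add_eq_sup] at hz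
    have h : (P.Jbar a (nDeg a (i + 2)) ⊔ P.Jbar b (nDeg b (i + 2))).baseChange P.Alg ≤
        (P.Jbar a (nDeg a (i + 2))).baseChange P.Alg ⊔
          (P.Jbar b (nDeg b (i + 2))).baseChange P.Alg := by
      rw [Submodule.baseChange_eq_span, Submodule.span_le]
      rintro _ ⟨w, hw, rfl⟩
      obtain ⟨x, hx, y, hy, rfl⟩ := Submodule.mem_sup.1 hw
      rw [map_add]
      exact add_mem (Submodule.mem_sup_left (Submodule.tmul_mem_baseChange_of_mem _ hx))
        (Submodule.mem_sup_right (Submodule.tmul_mem_baseChange_of_mem _ hy))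
    obtain ⟨_, hx, _, hy, rfl⟩ := Submodule.mem_sup.1 (h hz)
    obtain ⟨x, hx', rfl⟩ := (mem_baseChange_iff ha).1 hx
    obtain ⟨y, hy', rfl⟩ := (mem_baseChange_iff hb).1 hy
    exact ⟨x, hx', y, hy', rfl⟩
  · rintro ⟨x, hx, y, hy, rfl⟩
    exact add_mem
      (Submodule.baseChange_mono _ (P.Jbar_le_J mem_pair_left _)
        ((mem_baseChange_iff ha).2 ⟨x, hx, rfl⟩))
      (Submodule.baseChange_mono _ (P.Jbar_le_J mem_pair_right _)
        ((mem_baseChange_iff hb).2 ⟨y, hy, rfl⟩))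

theorem deltaHat_add {x y : TensorAlgebra k V} (hx : x ∈ ⊤ * P.Jbar a (nDeg a (i + 2)))
    (hy : y ∈ ⊤ * P.Jbar b (nDeg b (i + 2))) :
    P.deltaHat (i + 2) (P.splitLast (nDeg a (i + 2)) x + P.splitLast (nDeg b (i + 2)) y) =
      P.splitLast (nDeg a (i + 1)) x + P.splitLast (nDeg b (i + 1)) y := by
  rw [map_add, deltaHat_splitLast mem_pair_left hx, deltaHat_splitLast mem_pair_right hy]

/-- A relation `∑ₛ splitLast xₛ = 0` splits into its components. -/
theorem splitLast_add_eq_zero (hab : a ≠ b) (hi : 2 ≤ i) {x y : TensorAlgebra k V}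
    (hx : x ∈ ⊤ * tpow k V (nDeg a i)) (hy : y ∈ ⊤ * tpow k V (nDeg b i)) :
    P.splitLast (nDeg a i) x + P.splitLast (nDeg b i) y = 0 ↔
      x ∈ P.relSubmodule * tpow k V (nDeg a i) ∧ y ∈ P.relSubmodule * tpow k V (nDeg b i) := by
  rw [← splitLast_eq_zero_iff hx, ← splitLast_eq_zero_iff hy]
  refine ⟨fun h => ?_, fun h => by rw [h.1, h.2, add_zero]⟩
  have h1 := Submodule.disjoint_def.1 (disjoint_baseChange_tpow (P := P)
    (fun h => hab (nDeg_injective hi h))) _ ((mem_baseChange_iff le_rfl).2 ⟨x, hx, rfl⟩)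
    (by
      rw [eq_neg_of_add_eq_zero_left h]
      exact neg_mem ((mem_baseChange_iff le_rfl).2 ⟨y, hy, rfl⟩))
  rw [h1, zero_add] at h
  exact ⟨h1, h⟩

theorem top_mul_Jbar_succ_le (hs : s ∈ ({a, b} : Finset ℕ)) (hi : 2 ≤ i) :
    ⊤ * P.Jbar s (nDeg s (i + 1)) ≤ ⊤ * P.Jbar s (nDeg s i) := by
  have h1 := le_nDeg s hi
  have h2 := nDeg_le_nDeg_succ (P.two_le s hs) i
  refine (mul_le_mul_right (Jbar_le_tpow_mul_Jbar (c := (nDeg s (i + 1) : ℤ) - nDeg s i)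
    (q := nDeg s i) (by omega) (by omega) (by omega)) _).trans ?_
  rw [← mul_assoc]
  exact mul_le_mul_left le_top _

theorem top_mul_Jbar_add_two_le (hs : s ∈ ({a, b} : Finset ℕ)) :
    ⊤ * P.Jbar s (nDeg s (i + 2)) ≤ P.relSubmodule * tpow k V (nDeg s i) := by
  have h1 := le_nDeg s (show 2 ≤ i + 2 by omega)
  have h2 := nDeg_add_two s i
  refine (mul_le_mul_right (Jbar_le_block (i := 0) (j := nDeg s i) (by omega) (by omega) le_rfl
    (by omega)) _).trans ?_
  rw [← R_mul_tpow, ← mul_assoc]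
  exact mul_le_mul_left ((mul_le_mul_right (R_le_relSubmodule hs) _).trans mul_relSubmodule_le) _

theorem splitLast_eq_zero_of_mem {q : ℕ} {Y : Submodule k (TensorAlgebra k V)}
    (hY : Y ≤ tpow k V q) {x : TensorAlgebra k V} (hx : x ∈ P.relSubmodule * Y) :
    P.splitLast q x = 0 := by
  have h1 := mul_le_mul_right hY P.relSubmodule hx
  exact (splitLast_eq_zero_iff ((mul_le_mul_left le_top _ :
    P.relSubmodule * tpow k V q ≤ ⊤ * _) h1)).2 h1

/-- If `splitLast w - splitLast x` vanishes in one component, then `x` and `w` agree up to the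
relations. -/
theorem mem_of_splitLast_sub (hs : s ∈ ({a, b} : Finset ℕ)) (hi : 2 ≤ i) {x w : TensorAlgebra k V}
    (hx : x ∈ ⊤ * P.Jbar s (nDeg s i)) (hw : w ∈ ⊤ * P.Jbar s (nDeg s (i + 1)))
    (h : w - x ∈ P.relSubmodule * tpow k V (nDeg s i)) :
    x ∈ ⊤ * P.Jbar s (nDeg s (i + 1)) ⊔ P.relSubmodule * P.Jbar s (nDeg s i) := by
  rw [← sub_sub_cancel w x]
  refine sub_mem (Submodule.mem_sup_left hw) (Submodule.mem_sup_right ?_)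
  exact mul_inf_mul_le_of_le_tpow (P.Jbar_le_tpow hs _)
    ⟨sub_mem (top_mul_Jbar_succ_le hs hi hw) hx, h⟩

/-- `hcomp` says that the composite of two consecutive differentials vanishes. Cycles and boundaries
are compared on representatives, which are unique up to `⟨R⟩ J̄`. -/
theorem exact_iff (hab : a ≠ b) (hcomp : ∀ x ∈ ⊤ * P.Jbar a (nDeg a (i + 3)),
      ∀ y ∈ ⊤ * P.Jbar b (nDeg b (i + 3)),
      P.splitLast (nDeg a (i + 1)) x + P.splitLast (nDeg b (i + 1)) y = 0) :
    Function.Exact (P.delta (i + 2)) (P.delta (i + 1)) ↔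
      ∀ x ∈ ⊤ * P.Jbar a (nDeg a (i + 2)), ∀ y ∈ ⊤ * P.Jbar b (nDeg b (i + 2)),
        P.splitLast (nDeg a (i + 1)) x + P.splitLast (nDeg b (i + 1)) y = 0 →
          x ∈ ⊤ * P.Jbar a (nDeg a (i + 3)) ⊔ P.relSubmodule * P.Jbar a (nDeg a (i + 2)) ∧
          y ∈ ⊤ * P.Jbar b (nDeg b (i + 3)) ⊔ P.relSubmodule * P.Jbar b (nDeg b (i + 2)) := by
  have ha := P.Jbar_le_tpow mem_pair_left (nDeg a (i + 2))
  have hb := P.Jbar_le_tpow mem_pair_right (nDeg b (i + 2))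
  rw [exact_delta_iff]
  constructor
  · intro h x hx y hy hxy
    obtain ⟨w, hw, hwz⟩ := (h _ ((mem_K_add_two hab).2 ⟨x, hx, y, hy, rfl⟩)).1
      ((deltaHat_add hx hy).trans hxy)
    obtain ⟨x', hx', y', hy', rfl⟩ := (mem_K_add_two (i := i + 1) hab).1 hw
    rw [deltaHat_add (i := i + 1) hx' hy', ← sub_eq_zero, add_sub_add_comm, ← map_sub,
      ← map_sub] at hwz
    have h1 := (splitLast_add_eq_zero hab (show 2 ≤ i + 2 by omega)
      (mul_le_mul_right ha _ (sub_mem (top_mul_Jbar_succ_le mem_pair_left (by omega) hx') hx))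
      (mul_le_mul_right hb _ (sub_mem (top_mul_Jbar_succ_le mem_pair_right (by omega) hy') hy))).1
      hwz
    exact ⟨mem_of_splitLast_sub mem_pair_left (by omega) hx hx' h1.1,
      mem_of_splitLast_sub mem_pair_right (by omega) hy hy' h1.2⟩
  · intro h z hz
    obtain ⟨x, hx, y, hy, rfl⟩ := (mem_K_add_two hab).1 hz
    rw [deltaHat_add hx hy]
    constructor
    · intro hxy
      obtain ⟨h1, h2⟩ := h x hx y hy hxy
      obtain ⟨x', hx', p, hp, rfl⟩ := Submodule.mem_sup.1 h1
      obtain ⟨y', hy', q, hq, rfl⟩ := Submodule.mem_sup.1 h2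
      refine ⟨_, (mem_K_add_two (i := i + 1) hab).2 ⟨x', hx', y', hy', rfl⟩, ?_⟩
      rw [deltaHat_add (i := i + 1) hx' hy', map_add, map_add, splitLast_eq_zero_of_mem ha hp,
        splitLast_eq_zero_of_mem hb hq, add_zero, add_zero]
    · rintro ⟨w, hw, hwz⟩
      obtain ⟨x', hx', y', hy', rfl⟩ := (mem_K_add_two (i := i + 1) hab).1 hw
      have h1 := congrArg (P.deltaHat (i + 2)) hwz
      rw [deltaHat_add hx hy, deltaHat_add (i := i + 1) hx' hy', deltaHat_add
        (top_mul_Jbar_succ_le mem_pair_left (by omega) hx')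
        (top_mul_Jbar_succ_le mem_pair_right (by omega) hy')] at h1
      rw [← h1]
      exact hcomp x' hx' y' hy'

/-- For `i ≥ 2` the numbers `n_a(i)` and `n_b(i)` differ, so a cycle is a pair of cycles. -/
theorem exact_iff_of_two_le (hab : a ≠ b) (hi : 2 ≤ i) :
    Function.Exact (P.delta (i + 1)) (P.delta i) ↔ ∀ s ∈ ({a, b} : Finset ℕ),
      ⊤ * P.Jbar s (nDeg s (i + 1)) ⊓ P.relSubmodule * tpow k V (nDeg s i) ≤
        ⊤ * P.Jbar s (nDeg s (i + 2)) ⊔ P.relSubmodule * P.Jbar s (nDeg s (i + 1)) := by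
  obtain ⟨i, rfl⟩ : ∃ j, i = j + 1 := ⟨i - 1, by omega⟩
  have hT {s : ℕ} (hs : s ∈ ({a, b} : Finset ℕ)) :
      ⊤ * P.Jbar s (nDeg s (i + 2)) ≤ ⊤ * tpow k V (nDeg s (i + 1)) :=
    (top_mul_Jbar_succ_le hs hi).trans (mul_le_mul_right (P.Jbar_le_tpow hs _) _)
  rw [exact_iff hab]
  · simp only [Finset.mem_insert, Finset.mem_singleton, forall_eq_or_imp, forall_eq]
    constructor
    · refine fun h => ⟨fun x hx => ?_, fun y hy => ?_⟩
      · refine (h x hx.1 0 (zero_mem _) ?_).1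
        rw [map_zero, add_zero]
        exact (splitLast_eq_zero_iff (hT mem_pair_left hx.1)).2 hx.2
      · refine (h 0 (zero_mem _) y hy.1 ?_).2
        rw [map_zero, zero_add]
        exact (splitLast_eq_zero_iff (hT mem_pair_right hy.1)).2 hy.2
    · intro h x hx y hy hxy
      have h1 := (splitLast_add_eq_zero hab hi (hT mem_pair_left hx) (hT mem_pair_right hy)).1 hxy
      exact ⟨h.1 ⟨hx, h1.1⟩, h.2 ⟨hy, h1.2⟩⟩
  · intro x hx y hy
    rw [splitLast_eq_zero_of_mem le_rfl (top_mul_Jbar_add_two_le mem_pair_left hx),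
      splitLast_eq_zero_of_mem le_rfl (top_mul_Jbar_add_two_le mem_pair_right hy), add_zero]

/-- Since `n_a(1) = n_b(1) = 1`, both components map to `A ⊗ V` and only the sum `x + y` is
constrained. This is the source of bidistributivity. -/
theorem exact_delta_two_iff (hab : a ≠ b) :
    Function.Exact (P.delta 2) (P.delta 1) ↔ ∀ x ∈ ⊤ * P.R a, ∀ y ∈ ⊤ * P.R b,
      x + y ∈ P.relSubmodule * tpow k V 1 →
        x ∈ ⊤ * P.Jbar a (a + 1) ⊔ P.relSubmodule * P.R a ∧
        y ∈ ⊤ * P.Jbar b (b + 1) ⊔ P.relSubmodule * P.R b := by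
  have h1 (s : ℕ) : nDeg s 1 = 1 := by simp [nDeg]
  have hT {s : ℕ} (hs : s ∈ ({a, b} : Finset ℕ)) : ⊤ * P.R s ≤ ⊤ * tpow k V 1 :=
    (mul_le_mul_right (P.le_tpow s hs) _).trans
      (top_mul_tpow_le (q' := 1) (by have := P.two_le s hs; omega))
  rw [exact_iff (i := 0) hab]
  · simp only [zero_add, nDeg_two, nDeg_three, Nat.cast_add, Nat.cast_one, Jbar_self, h1, ← map_add]
    refine forall₂_congr fun x hx => forall₂_congr fun y hy => ?_
    rw [splitLast_eq_zero_iff (q := 1) (add_mem (hT mem_pair_left hx) (hT mem_pair_right hy))]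
    rfl
  · intro x hx y hy
    rw [splitLast_eq_zero_of_mem le_rfl (top_mul_Jbar_add_two_le mem_pair_left hx),
      splitLast_eq_zero_of_mem le_rfl (top_mul_Jbar_add_two_le mem_pair_right hy), add_zero]

/-- This is exactness at index `1`: modulo `⟨R⟩ V`, the ideal is generated as a left ideal by the
relations. -/
theorem relSubmodule_le_sup :
    P.relSubmodule ≤ (⊤ * P.R a ⊔ ⊤ * P.R b) ⊔ P.relSubmodule * tpow k V 1 := by
  have hmul {Y Z : Submodule k (TensorAlgebra k V)} (hZ : ⊤ * Z ≤ Z) :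
      ⊤ * (Z * Y) ≤ Z * Y := by
    rw [← mul_assoc]
    exact mul_le_mul_left hZ _
  refine relSubmodule_le (fun s hs x hx => ?_) (fun u x hx => ?_) (fun u x hx hx' => ?_)
  · have h1 := Submodule.mul_mem_mul (Submodule.mem_top (R := k) (x := (1 : TensorAlgebra k V))) hx
    rw [one_mul] at h1
    refine Submodule.mem_sup_left ?_
    obtain rfl | rfl : s = a ∨ s = b := by simpa using hs
    · exact Submodule.mem_sup_left h1
    · exact Submodule.mem_sup_right h1
  · have h1 := Submodule.mul_mem_mul (Submodule.mem_top (R := k) (x := u)) hx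
    rw [Submodule.mul_sup, Submodule.mul_sup] at h1
    exact sup_le_sup (sup_le_sup (hmul le_top) (hmul le_top)) (hmul mul_relSubmodule_le) h1
  -- Separate the constant term of `u`; the rest of `u` ends in a letter, so its product with `x`
  -- lies in `⟨R⟩ V`.
  · rw [show x * u = TensorAlgebra.algebraMapInv u • x +
      x * (u - algebraMap k _ (TensorAlgebra.algebraMapInv u)) by
        rw [mul_sub, ← Algebra.commutes, ← Algebra.smul_def]; abel]
    refine add_mem (Submodule.smul_mem _ _ hx') (Submodule.mem_sup_right ?_)
    have h1 := Submodule.mul_mem_mul hx (sub_algebraMapInv_mem u)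
    rw [← mul_assoc] at h1
    exact mul_le_mul_left relSubmodule_mul_le _ h1

theorem exact_delta_one (hab : a ≠ b) : Function.Exact (P.delta 1) (P.delta 0) := by
  have h1 (s : ℕ) : nDeg s 1 = 1 := by simp [nDeg]
  have hR {s : ℕ} (hs : s ∈ ({a, b} : Finset ℕ)) : ⊤ * P.R s ≤ P.relSubmodule :=
    (mul_le_mul_right (R_le_relSubmodule hs) _).trans mul_relSubmodule_le
  have hT {s : ℕ} (hs : s ∈ ({a, b} : Finset ℕ)) : ⊤ * P.R s ≤ ⊤ * tpow k V 1 :=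
    (mul_le_mul_right (P.le_tpow s hs) _).trans
      (top_mul_tpow_le (q' := 1) (by have := P.two_le s hs; omega))
  have hd {x y : TensorAlgebra k V} (hx : x ∈ ⊤ * P.R a) (hy : y ∈ ⊤ * P.R b) :
      P.deltaHat 2 (P.splitLast (nDeg a 2) x + P.splitLast (nDeg b 2) y) =
        P.splitLast 1 (x + y) := by
    rw [deltaHat_add (i := 0) (by simpa [nDeg_two, Jbar_self] using hx)
      (by simpa [nDeg_two, Jbar_self] using hy), h1, h1, map_add]
  have h0 {x : TensorAlgebra k V} (hx : x ∈ ⊤ * tpow k V 1) :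
      P.splitLast 0 x = 0 ↔ x ∈ P.relSubmodule := by
    have h2 := splitLast_eq_zero_iff (P := P) (top_mul_tpow_le (q := 1) zero_le_one hx)
    rwa [Nat.cast_zero, tpow_zero, mul_one] at h2
  rw [exact_delta_iff]
  intro z hz
  obtain ⟨x, hx, rfl⟩ := mem_K_one.1 hz
  rw [deltaHat_one_splitLast hx, h0 hx]
  constructor
  · intro h
    obtain ⟨y, hy, r, hr, rfl⟩ := Submodule.mem_sup.1 (relSubmodule_le_sup h)
    obtain ⟨ya, hya, yb, hyb, rfl⟩ := Submodule.mem_sup.1 hy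
    refine ⟨_, (mem_K_add_two (i := 0) hab).2 ⟨ya, by simpa [nDeg_two, Jbar_self] using hya, yb,
      by simpa [nDeg_two, Jbar_self] using hyb, rfl⟩, ?_⟩
    rw [hd hya hyb, map_add _ _ r, splitLast_eq_zero_of_mem (q := 1) le_rfl hr, add_zero]
  · rintro ⟨w, hw, hwx⟩
    obtain ⟨ya, hya, yb, hyb, rfl⟩ := (mem_K_add_two (i := 0) hab).1 hw
    simp only [zero_add, nDeg_two, Jbar_self] at hya hyb
    rw [hd hya hyb] at hwx
    have h2 := congrArg (P.deltaHat 1) hwx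
    rw [deltaHat_one_splitLast hx, deltaHat_one_splitLast
      (add_mem (hT mem_pair_left hya) (hT mem_pair_right hyb)),
      (h0 (add_mem (hT mem_pair_left hya) (hT mem_pair_right hyb))).2
        (add_mem (hR mem_pair_left hya) (hR mem_pair_right hyb))] at h2
    exact (h0 hx).1 h2.symm

/-! ### Passage to homogeneous components -/

theorem tpow_mul_le_top_mul {n : ℤ} {Y : Submodule k (TensorAlgebra k V)} :
    tpow k V n * Y ≤ ⊤ * Y := mul_le_mul_left le_top _

theorem component_mem_sup {q q' n : ℕ} {Y Z : Submodule k (TensorAlgebra k V)}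
    (hY : Y ≤ tpow k V q) (hZ : Z ≤ tpow k V q') {x : TensorAlgebra k V}
    (hx : x ∈ ⊤ * Y ⊔ P.relSubmodule * Z) :
    component k V n x ∈ tpow k V (n - q) * Y ⊔ P.I (n - q') * Z := by
  obtain ⟨y, hy, z, hz, rfl⟩ := Submodule.mem_sup.1 hx
  rw [map_add]
  exact add_mem (Submodule.mem_sup_left (component_mem_top_mul hY hy))
    (Submodule.mem_sup_right (component_mem_I_mul hZ hz))

/-- All the spaces involved are homogeneous, so the inclusion in `T(V)` may be tested on homogeneous
components. -/
theorem forall_exactAt_iff (hs : s ∈ ({a, b} : Finset ℕ)) :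
    (∀ n : ℕ, P.ExactAt s i n) ↔
      ⊤ * P.Jbar s (nDeg s (i + 1)) ⊓ P.relSubmodule * tpow k V (nDeg s i) ≤
        ⊤ * P.Jbar s (nDeg s (i + 2)) ⊔ P.relSubmodule * P.Jbar s (nDeg s (i + 1)) := by
  have hJ (m : ℤ) := P.Jbar_le_tpow hs m
  constructor
  · rintro h x ⟨hx, hx'⟩
    refine sum_component x fun n => ?_
    exact sup_le_sup tpow_mul_le_top_mul (mul_le_mul_left I_le_relSubmodule _)
      (h n ⟨component_mem_top_mul (hJ _) hx, component_mem_I_mul le_rfl hx'⟩)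
  · rintro h n x ⟨hx, hx'⟩
    have hxn : x ∈ tpow k V n :=
      tpow_mul_tpow_le (by ring) (mul_le_mul_right (hJ _) _ hx)
    rw [← component_of_mem hxn]
    exact component_mem_sup (hJ _) (hJ _)
      (h ⟨tpow_mul_le_top_mul hx, mul_le_mul_left I_le_relSubmodule _ hx'⟩)

theorem forall_exactAtTwo_iff :
    (∀ n : ℕ, P.ExactAtTwo a b n) ↔ ∀ x ∈ ⊤ * P.R a, ∀ y ∈ ⊤ * P.R b,
      x + y ∈ P.relSubmodule * tpow k V 1 →
        x ∈ ⊤ * P.Jbar a (a + 1) ⊔ P.relSubmodule * P.R a ∧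
        y ∈ ⊤ * P.Jbar b (b + 1) ⊔ P.relSubmodule * P.R b := by
  have hR {s : ℕ} (hs : s ∈ ({a, b} : Finset ℕ)) := P.le_tpow s hs
  have hJ {s : ℕ} (hs : s ∈ ({a, b} : Finset ℕ)) : P.Jbar s (s + 1) ≤ tpow k V (s + 1 : ℕ) :=
    P.Jbar_le_tpow hs _
  constructor
  · intro h x hx y hy hxy
    have h1 (n : ℕ) := h n _ (by
      rw [← tpow_mul_R]
      exact component_mem_top_mul (hR mem_pair_left) hx) _ (by
      rw [← tpow_mul_R]
      exact component_mem_top_mul (hR mem_pair_right) hy) (by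
      rw [← map_add]
      exact component_mem_I_mul (q := 1) le_rfl hxy)
    exact ⟨sum_component x fun n => sup_le_sup tpow_mul_le_top_mul
        (mul_le_mul_left I_le_relSubmodule _) (h1 n).1,
      sum_component y fun n => sup_le_sup tpow_mul_le_top_mul
        (mul_le_mul_left I_le_relSubmodule _) (h1 n).2⟩
  · intro h n x hx y hy hxy
    have hxn : x ∈ tpow k V n := block_le_tpow mem_pair_left (by ring) hx
    have hyn : y ∈ tpow k V n := block_le_tpow mem_pair_right (by ring) hy
    rw [← tpow_mul_R] at hx hy
    obtain ⟨h1, h2⟩ := h x (tpow_mul_le_top_mul hx) y (tpow_mul_le_top_mul hy)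
      (mul_le_mul_left I_le_relSubmodule _ hxy)
    have h3 := component_mem_sup (n := n) (hJ mem_pair_left) (hR mem_pair_left) h1
    have h4 := component_mem_sup (n := n) (hJ mem_pair_right) (hR mem_pair_right) h2
    rw [component_of_mem hxn, Nat.cast_add, Nat.cast_one, ← sub_sub] at h3
    rw [component_of_mem hyn, Nat.cast_add, Nat.cast_one, ← sub_sub] at h4
    exact ⟨h3, h4⟩

theorem isMultiKoszul_iff (hab : a ≠ b) :
    P.IsMultiKoszul ↔ (∀ n : ℕ, P.ExactAtTwo a b n) ∧
      ∀ i : ℕ, 2 ≤ i → ∀ s ∈ ({a, b} : Finset ℕ), ∀ n : ℕ, P.ExactAt s i n := by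
  rw [forall_exactAtTwo_iff, ← exact_delta_two_iff hab]
  have h1 (i : ℕ) (hi : 2 ≤ i) : Function.Exact (P.delta (i + 1)) (P.delta i) ↔
      ∀ s ∈ ({a, b} : Finset ℕ), ∀ n : ℕ, P.ExactAt s i n := by
    rw [exact_iff_of_two_le hab hi]
    exact forall₂_congr fun s hs => (forall_exactAt_iff hs).symm
  refine ⟨fun h => ⟨h.2.2 1, fun i hi => (h1 i hi).1 (h.2.2 i)⟩,
    fun h => ⟨surjective_delta₀, exact_delta_delta₀, fun i => ?_⟩⟩
  match i with
  | 0 => exact exact_delta_one hab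
  | 1 => exact h.1
  | i + 2 => exact (h1 _ (by omega)).2 (h.2 _ (by omega))

end Presentation

end MultiKoszul

end

/-! ### The equivalence -/

theorem mainTheorem5 {k V : Type*} [Field k] [AddCommGroup V] [Module k V] [FiniteDimensional k V]
    (a b : ℕ) (ha : 2 ≤ a) (hab : a < b) (P : MultiKoszul.Presentation k V {a, b}) :
    List.TFAE [
      (P.ExtraCondition a ∧ P.ExtraCondition b) ∧
        (∀ i : ℕ, 3 ≤ i → Even i → ∀ n : ℕ,
          MultiKoszul.nDeg a (i - 1) + b ≤ n → n ≤ MultiKoszul.nDeg a i + b - 1 →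
            P.EvenInclusion a b i n) ∧
        (∀ i : ℕ, 3 ≤ i → Odd i → P.OddInclusion a b i) ∧
        (∀ n : ℕ, P.BidistributiveAt a b n) ∧
        (∀ i : ℕ, 3 ≤ i → ∀ s ∈ ({a, b} : Finset ℕ), ∀ n : ℕ, P.DistributiveAt a b s i n),
      (P.ExtraCondition a ∧ P.ExtraCondition b) ∧
        (∀ i : ℕ, 3 ≤ i → Even i → ∀ n : ℕ,
          MultiKoszul.nDeg a (i - 1) + b ≤ n → n ≤ MultiKoszul.nDeg a i + b - 1 →
            P.EvenInclusion a b i n) ∧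
        (∀ i : ℕ, 3 ≤ i → Odd i → P.OddInclusion a b i) ∧
        (∀ n : ℕ, a < n → P.BidistributiveAt a b n) ∧
        (∀ i : ℕ, 3 ≤ i → ∀ s ∈ ({a, b} : Finset ℕ), ∀ n : ℕ, MultiKoszul.nDeg s i ≤ n →
          P.DistributiveAt a b s i n),
      P.IsMultiKoszul] := by
  tfae_have 1 → 2 := fun h => ⟨h.1, h.2.1, h.2.2.1, fun n _ => h.2.2.2.1 n,
    fun i hi s hs n _ => h.2.2.2.2 i hi s hs n⟩
  -- The omitted degrees are automatic: for `n ≤ a` no relation fits into `n - 1` letters, and for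
  -- `n < n_s(i)` the space `E^s` is zero.
  tfae_have 2 → 1 := fun h => by
    refine ⟨h.1, h.2.1, h.2.2.1, fun n => ?_, fun i hi s hs n => ?_⟩
    · obtain hn | hn := le_or_gt n a
      · exact MultiKoszul.Presentation.bidistributiveAt_of_le ha hab (by omega)
      · exact h.2.2.2.1 n hn
    · obtain hn | hn := lt_or_ge n (MultiKoszul.nDeg s i)
      · obtain ⟨i, rfl⟩ : ∃ j, i = j + 1 := ⟨i - 1, by omega⟩
        exact MultiKoszul.Presentation.distributiveAt_of_lt (P.two_le s hs) (by omega)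
      · exact h.2.2.2.2 i hi s hs n hn
  tfae_have 2 ↔ 3 := (P.lattice_conditions_iff ha hab).trans
    (MultiKoszul.Presentation.isMultiKoszul_iff hab.ne).symm
  tfae_finish
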